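/- \textbf{Conventions.} Let $n\ge 1$ and let $Q$ be a quiver whose set of arrows is partitioned into $n+1$ non-empty parts, called \emph{arrow types}. A path is \emph{admissible} if some arrow type does not occur in it, and \emph{simple} if each arrow type occurs in it at most once; its \emph{essential type} is the set of arrow types occurring in it. $Q$ is a \emph{$\mathbb Z^n$-quiver} if (1) exactly one arrow of each type leaves each vertex, (2) each vertex is connected to each other vertex by an admissible path, (3) each maximal simple path is a circuit (these are called \emph{minimal circuits}), and (4) two admissible paths leaving the same vertex arrive at the same vertex if and only if they contain the same number of arrows of each type. Two distinct vertices are \emph{neighbors} if an admissible simple path connects the first to the second. For a vertex $v$ and a set $I$ of arrow types, all simple paths leaving $v$ with essential type $I$ end at the same vertex, denoted $I\cdot v$. Let $k$ be a field and let $\mathcal A$ be a $k$-linear abelian category which is \emph{semisimple}, that is, each of its objects is a finite (possibly empty) direct sum of simple objects. For a representation $\mathfrak V$ of $Q$ in $\mathcal A$, let $V_v$ be the object at the vertex $v$ and $\varphi_\gamma$ the composition of the maps along the path $\gamma$ (the identity for a trivial path). $\mathfrak V$ is a \emph{linked net} if (1) whenever $\gamma_1,\gamma_2$ are paths connecting the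 same two vertices and $\gamma_2$ is admissible, $\varphi_{\gamma_1}$ is a scalar multiple of $\varphi_{\gamma_2}$; (2) $\varphi_\gamma=0$ for each minimal circuit $\gamma$; (3) $\operatorname{Ker}(\varphi_{\gamma_1})\cap\operatorname{Ker}(\varphi_{\gamma_2})=0$ for any two admissible paths $\gamma_1,\gamma_2$ leaving the same vertex with no arrow type in common. By (1), the map $\varphi_\gamma$ of an admissible path $\gamma$ from $u$ to $v$ depends, up to a nonzero scalar, only on $u$ and $v$; write $\varphi^u_v$ for it. A linked net is \emph{exact} if $\operatorname{Ker}(\varphi^{u_1}_{u_2})=\operatorname{Im}(\varphi^{u_2}_{u_1})$ for any two neighbors $u_1,u_2$, and \emph{locally finite} if for each vertex $v$ there is an integer $\ell$ with $\varphi_\mu=0$ for every path $\mu$ of length greater than $\ell$ arriving at $v$. Let $\varphi^v_I\colon V_v\to V_{I\cdot v}$ be the map, well defined up to a nonzero scalar, of a simple path leaving $v$ with essential type $I$ (so $\varphi^v_I=0$ if $I$ is the set of all arrow types). $\mathfrak V$ \emph{satisfies the intersection property at $v$} if for every $m\ge 0$ and all sets $I_0,\dots,I_m$ of arrow types $$\Big(\sum_{\ell=1}^m\operatorname{Ker}(\varphi^v_{I_\ell})\Big)\cap\operatorname{Ker}(\varphi^v_{I_0})=\sum_{\ell=1}^m\operatorname{Ker}(\varphi^v_{I_\ell\cap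 I_0}).$$ Let $\mathcal C_Q(\mathcal A)$ be the category of locally finite exact linked nets over $Q$ of objects in $\mathcal A$, with all maps of representations as morphisms. An object of $\mathcal C_Q(\mathcal A)$ is \emph{simple} in it if it is nonzero and every nonzero monomorphism of $\mathcal C_Q(\mathcal A)$ into it is an isomorphism, and \emph{semisimple} in it if it is a finite (possibly empty) direct sum of simple objects of $\mathcal C_Q(\mathcal A)$. \textbf{Theorem.} Let $\mathfrak V$ be a locally finite exact linked net over a $\mathbb Z^n$-quiver $Q$ of objects in a $k$-linear semisimple abelian category $\mathcal A$. Then $\mathfrak V$ is simple in $\mathcal C_Q(\mathcal A)$ if and only if each object $V_v$ is simple in $\mathcal A$. Moreover, $\mathfrak V$ is semisimple in $\mathcal C_Q(\mathcal A)$ if and only if $\mathfrak V$ satisfies the intersection property at every vertex of $Q$. -/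

import Mathlib

open CategoryTheory CategoryTheory.Limits

universe v₁ u₁ v₂ u₂ w

/-! ## Quivers with a partition of the arrows into types, and `ℤⁿ`-quivers -/

/-- A partition of the arrows of the quiver `V` into the `n + 1` arrow types
`A_0, …, A_n` (the fibres of `arrowType`), all of them non-empty. -/
structure ArrowPartition (n : ℕ) (V : Type u₁) [Quiver.{v₁} V] where
  /-- the index of the part which an arrow belongs to -/
  arrowType : ∀ {u v : V}, (u ⟶ v) → Fin (n + 1)
  exists_arrow : ∀ t : Fin (n + 1), ∃ (u v : V) (a : u ⟶ v), arrowType a = t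

namespace ArrowPartition

variable {n : ℕ} {V : Type u₁} [Quiver.{v₁} V] (S : ArrowPartition n V)

/-- The type of a path: the number of its arrows of each arrow type. -/
def pathType {u : V} : ∀ {v : V}, Quiver.Path u v → Fin (n + 1) → ℕ
  | _, .nil => 0
  | _, .cons p a => pathType p + Pi.single (S.arrowType a) 1

/-- The essential type of a path: the set of the arrow types that occur in it. -/
def essentialType {u v : V} (p : Quiver.Path u v) : Finset (Fin (n + 1)) :=
  Finset.univ.filter fun t => 0 < S.pathType p t

/-- A path is admissible if it contains no arrow of a certain type. -/
def IsAdmissible {u v : V} (p : Quiver.Path u v) : Prop :=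
  ∃ t, S.pathType p t = 0

/-- A path is simple if it contains at most one arrow of each type. -/
def IsSimplePath {u v : V} (p : Quiver.Path u v) : Prop :=
  ∀ t, S.pathType p t ≤ 1

/-- A maximal simple path: a simple path which is not part of a longer simple path. (These are
the minimal circuits of a `ℤⁿ`-quiver.) -/
def IsMaximalSimplePath {u v : V} (p : Quiver.Path u v) : Prop :=
  S.IsSimplePath p ∧
    ∀ {u' v' : V} (q : Quiver.Path u' u) (r : Quiver.Path v v'),
      S.IsSimplePath ((q.comp p).comp r) → q.length = 0 ∧ r.length = 0

/-- Distinct vertices `u₁`, `u₂` are neighbors if there is an admissible simple path from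
`u₁` to `u₂`. -/
def AreNeighbors (u₁ u₂ : V) : Prop :=
  u₁ ≠ u₂ ∧ ∃ p : Quiver.Path u₁ u₂, S.IsAdmissible p ∧ S.IsSimplePath p

end ArrowPartition

/-- A `ℤⁿ`-structure on the quiver `V` (that is, `V` is a `ℤⁿ`-quiver). -/
structure ZnQuiver (n : ℕ) (V : Type u₁) [Quiver.{v₁} V] extends ArrowPartition n V where
  n_pos : 0 < n
  /-- exactly one arrow of each type leaves each vertex -/
  existsUnique_arrow : ∀ (u : V) (t : Fin (n + 1)),
    ∃! a : (Σ v : V, (u ⟶ v)), toArrowPartition.arrowType a.2 = t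
  /-- each vertex is connected to each other by an admissible path -/
  exists_admissible : ∀ u v : V, u ≠ v →
    ∃ p : Quiver.Path u v, toArrowPartition.IsAdmissible p
  /-- each maximal simple path is a circuit -/
  circuit : ∀ {u v : V} (p : Quiver.Path u v), toArrowPartition.IsMaximalSimplePath p → u = v
  /-- two admissible paths leaving the same vertex arrive at the same vertex if and only if they
  are of the same type -/
  target_eq_iff : ∀ {u v w : V} (p : Quiver.Path u v) (q : Quiver.Path u w),
    toArrowPartition.IsAdmissible p → toArrowPartition.IsAdmissible q →
      (v = w ↔ toArrowPartition.pathType p = toArrowPartition.pathType q)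

namespace ZnQuiver

variable {n : ℕ} {V : Type u₁} [Quiver.{v₁} V] (Q : ZnQuiver n V)

/-- The unique arrow of type `t` leaving `u`, with its target. -/
noncomputable def arrow (u : V) (t : Fin (n + 1)) : Σ v : V, (u ⟶ v) :=
  (Q.existsUnique_arrow u t).choose

lemma arrowType_arrow (u : V) (t : Fin (n + 1)) : Q.arrowType (Q.arrow u t).2 = t :=
  (Q.existsUnique_arrow u t).choose_spec.1

/-- The path leaving `u` whose successive arrows have the prescribed types, with its target. -/
noncomputable def pathOfTypes : ∀ (_ : List (Fin (n + 1))) (u : V), Σ v : V, Quiver.Path u v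
  | [], u => ⟨u, .nil⟩
  | t :: l, u =>
    ⟨(pathOfTypes l (Q.arrow u t).1).1,
      (Q.arrow u t).2.toPath.comp (pathOfTypes l (Q.arrow u t).1).2⟩

/-- A simple path leaving `u` with essential type `I`, with its target `I · u`: the one which
takes the arrow types in `I` in increasing order. -/
noncomputable def simplePath (u : V) (I : Finset (Fin (n + 1))) : Σ v : V, Quiver.Path u v :=
  Q.pathOfTypes I.sort u

lemma pathType_comp {u v : V} (p : Quiver.Path u v) :
    ∀ {w : V} (q : Quiver.Path v w), Q.pathType (p.comp q) = Q.pathType p + Q.pathType q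
  | _, .nil => by simp [ArrowPartition.pathType]
  | _, .cons q a => by
    simp [ArrowPartition.pathType, pathType_comp p q, add_assoc]

lemma pathType_pathOfTypes (l : List (Fin (n + 1))) (u : V) (t : Fin (n + 1)) :
    Q.pathType (Q.pathOfTypes l u).2 t = l.count t := by
  induction l generalizing u with
  | nil => simp [pathOfTypes, ArrowPartition.pathType]
  | cons s l ih =>
    simp only [pathOfTypes, pathType_comp, Pi.add_apply, ih, Quiver.Hom.toPath,
      ArrowPartition.pathType, arrowType_arrow, List.count_cons, Pi.single_apply, Pi.zero_apply]
    by_cases h : s = t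
    · subst h; simp [add_comm]
    · have h' : ¬ t = s := fun e => h e.symm
      simp [h, h']

lemma pathType_simplePath (u : V) (I : Finset (Fin (n + 1))) (t : Fin (n + 1)) :
    Q.pathType (Q.simplePath u I).2 t = if t ∈ I then 1 else 0 := by
  rw [simplePath, pathType_pathOfTypes]
  split_ifs with h
  · exact List.count_eq_one_of_mem (Finset.sort_nodup I _) ((Finset.mem_sort _).2 h)
  · exact List.count_eq_zero_of_not_mem fun h' => h ((Finset.mem_sort _).1 h')

lemma isSimplePath_simplePath (u : V) (I : Finset (Fin (n + 1))) :
    Q.IsSimplePath (Q.simplePath u I).2 := fun t => by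
  rw [pathType_simplePath]; split_ifs <;> simp

lemma essentialType_simplePath (u : V) (I : Finset (Fin (n + 1))) :
    Q.essentialType (Q.simplePath u I).2 = I := by
  ext t
  simp only [ArrowPartition.essentialType, Finset.mem_filter, Finset.mem_univ, true_and,
    pathType_simplePath]
  split_ifs with h <;> simp [h]

end ZnQuiver

/-! ## Representations and linked nets -/

/-- The category of representations of the quiver `V` in the category `A`: functors from the
free category on `V` to `A`; morphisms are the representation maps (natural transformations). -/
abbrev QuiverRep (V : Type u₁) [Quiver.{v₁} V] (A : Type u₂) [Category.{v₂} A] :=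
  Paths V ⥤ A

namespace QuiverRep

variable {V : Type u₁} [Quiver.{v₁} V] {A : Type u₂} [Category.{v₂} A]

/-- The object associated to a vertex. -/
abbrev objAt (F : QuiverRep V A) (v : V) : A := F.obj ((Paths.of V).obj v)

/-- The composition `φ_γ` of the maps associated to the arrows of a path `γ`. -/
abbrev pathMap (F : QuiverRep V A) {u v : V} (p : Quiver.Path u v) : F.objAt u ⟶ F.objAt v :=
  F.map (X := (Paths.of V).obj u) (Y := (Paths.of V).obj v) p

variable {n : ℕ} (k : Type w) [Field k] (Q : ZnQuiver n V)

/-- Weakly linked nets. -/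
structure IsWeaklyLinkedNet [Abelian A] [Linear k A] (F : QuiverRep V A) : Prop where
  /-- the map of a path is a scalar multiple of that of any admissible path with the same ends -/
  exists_smul : ∀ {u v : V} (p₁ p₂ : Quiver.Path u v), Q.IsAdmissible p₂ →
    ∃ c : k, F.pathMap p₁ = c • F.pathMap p₂
  /-- the maps of the minimal circuits are zero -/
  map_circuit : ∀ {u v : V} (p : Quiver.Path u v), Q.IsMaximalSimplePath p → F.pathMap p = 0

/-- Linked nets. -/
structure IsLinkedNet [Abelian A] [Linear k A] (F : QuiverRep V A) : Prop
    extends IsWeaklyLinkedNet k Q F where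
  /-- the kernels of the maps of two admissible paths leaving the same vertex and having no arrow
  type in common intersect trivially -/
  ker_inf_ker : ∀ {u v w : V} (p₁ : Quiver.Path u v) (p₂ : Quiver.Path u w),
    Q.IsAdmissible p₁ → Q.IsAdmissible p₂ → Disjoint (Q.essentialType p₁) (Q.essentialType p₂) →
      kernelSubobject (F.pathMap p₁) ⊓ kernelSubobject (F.pathMap p₂) = ⊥

/-- Exactness: `Ker(φ^{u₁}_{u₂}) = Im(φ^{u₂}_{u₁})` for any two neighbors `u₁`, `u₂`, where
`φ^u_v` is the map of any admissible path from `u` to `v` (for a weakly linked net, it is unique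
up to a nonzero scalar). -/
def IsExact [Abelian A] (F : QuiverRep V A) : Prop :=
  ∀ {u₁ u₂ : V}, Q.AreNeighbors u₁ u₂ →
    ∀ (p : Quiver.Path u₁ u₂) (q : Quiver.Path u₂ u₁), Q.IsAdmissible p → Q.IsAdmissible q →
      kernelSubobject (F.pathMap p) = imageSubobject (F.pathMap q)

/-- Local finiteness: for each vertex `v` the maps of all long enough paths arriving at `v` are
zero. -/
def IsLocallyFinite [HasZeroMorphisms A] (F : QuiverRep V A) : Prop :=
  ∀ v : V, ∃ l : ℕ, ∀ {u : V} (p : Quiver.Path u v), l < p.length → F.pathMap p = 0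

/-- All the objects associated to the vertices are simple. -/
def HasSimpleObjects [HasZeroMorphisms A] (F : QuiverRep V A) : Prop :=
  ∀ v : V, Simple (F.objAt v)

/-- The subobject `Ker(φ^v_I)` of the object associated to `v`, where `φ^v_I` is the map of a
simple path leaving `v` with essential type `I`. (For a weakly linked net, it does not depend on
the path: for `I` proper these maps are nonzero scalar multiples of each other or all zero, and
for `I` the set of all arrow types they are all zero.) -/
noncomputable def kerOfTypes [Abelian A] (F : QuiverRep V A) (v : V)
    (I : Finset (Fin (n + 1))) : Subobject (F.objAt v) :=
  kernelSubobject (F.pathMap (Q.simplePath v I).2)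

/-- The intersection property at the vertex `v`: for all sets `J = I_0, I_1, …, I_m` of arrow
types, `(∑_{l=1}^m Ker φ_{I_l}) ∩ Ker φ_{I_0} = ∑_{l=1}^m Ker φ_{I_l ∩ I_0}`. -/
def IntersectionPropertyAt [Abelian A] (F : QuiverRep V A) (v : V) : Prop :=
  ∀ (m : ℕ) (J : Finset (Fin (n + 1))) (I : Fin m → Finset (Fin (n + 1))),
    (Finset.univ.sup fun l => F.kerOfTypes Q v (I l)) ⊓ F.kerOfTypes Q v J =
      Finset.univ.sup fun l => F.kerOfTypes Q v (I l ∩ J)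

end QuiverRep

/-- The locally finite exact linked nets over `Q` of objects in `A`. -/
def isLocallyFiniteExactLinkedNet (k : Type w) [Field k] {n : ℕ} {V : Type u₁} [Quiver.{v₁} V]
    (Q : ZnQuiver n V) (A : Type u₂) [Category.{v₂} A] [Abelian A] [Linear k A] :
    ObjectProperty (QuiverRep V A) :=
  fun F => F.IsLinkedNet k Q ∧ F.IsExact Q ∧ F.IsLocallyFinite

/-- The category `𝒞_Q(A)` of locally finite exact linked nets over `Q` of objects in `A`, with
all representation maps as morphisms. -/
abbrev LinkedNetCat (k : Type w) [Field k] {n : ℕ} {V : Type u₁} [Quiver.{v₁} V]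
    (Q : ZnQuiver n V) (A : Type u₂) [Category.{v₂} A] [Abelian A] [Linear k A] :=
  (isLocallyFiniteExactLinkedNet k Q A).FullSubcategory

/-! ## Semisimple objects -/

/-- An object is semisimple if it is a finite (possibly empty) direct sum of simple objects. -/
def IsSemisimpleObject {C : Type u₂} [Category.{v₂} C] [HasZeroMorphisms C] (X : C) : Prop :=
  ∃ (m : ℕ) (S : Fin m → C) (b : Bicone S),
    (∀ i, Simple (S i)) ∧ Nonempty b.IsBilimit ∧ Nonempty (X ≅ b.pt)

/-! ### Types of admissible paths and predecessors in a `ℤⁿ`-quiver. -/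

namespace ZnQuiver

/-! Every object of `A` is projective, so kernels, images and sums of subobjects can be handled
through elements `x : X ⟶ V_v`. The building blocks are the nets `genNet` generated by an object `S`
at a vertex `v`: a copy of `S` everywhere, an arrow acting invertibly when it prolongs an admissible
path from `v` and by zero otherwise. They lie in `𝒞_Q(A)`, and each map `S ⟶ V_v` extends to a map
from such a net (`exists_hom_genNet`); hence monomorphisms of `𝒞_Q(A)` are monomorphisms at each
vertex (`LinkedNetCat.mono_app`).

Let `G_v` be a complement in `V_v` of the sum of the images of the arrows arriving at `v`. By local
finiteness the `G_v` generate the net (`eval_surjective`); condition (3) and exactness embed `G_v`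
in every `V_w` (`mono_incl_connMap`).

Simplicity: by exactness a net vanishing at one vertex vanishes everywhere (`isZero_of_isZero`), so
a nonzero subnet of a net with simple objects is the whole net. Conversely, a simple subobject of a
nonzero `G_v` generates a nonzero subnet with simple objects.

Semisimplicity: if the objects are simple, each kernel is zero or everything, and the intersection
property reduces to `Ker φ_I ∩ Ker φ_J ⊆ Ker φ_{I ∩ J}`, a consequence of condition (3)
(`comp_shiftPath_inter_eq_zero`). It passes to finite direct sums. Conversely, the intersection
property makes the `G_v` generate freely (`eval_injective`): the terms of a relation at `w` are
grouped by the set `I` of arrow types on their way to `w`, the property rewrites one group in terms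
of kernels coming from the others, and exactness transports the relation to the predecessor `w - I`,
where induction applies. Freeness, applied to the identity of a single `V_w`, leaves finitely many
nonzero `G_v`; splitting these into simple objects exhibits the net as a finite direct sum of nets
generated by simple objects. -/

/-- The type of a simple path of essential type `I`. -/
def indicatorType {n : ℕ} (I : Finset (Fin (n + 1))) : Fin (n + 1) → ℕ :=
  fun t => if t ∈ I then 1 else 0

variable {n : ℕ} {V : Type u₁} [Quiver.{v₁} V] (Q : ZnQuiver n V)

lemma pathType_nil (u : V) : Q.pathType (Quiver.Path.nil : Quiver.Path u u) = 0 := rfl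

lemma pathType_cons {u v w : V} (p : Quiver.Path u v) (a : v ⟶ w) :
    Q.pathType (p.cons a) = Q.pathType p + Pi.single (Q.arrowType a) 1 := rfl

lemma isAdmissible_nil (u : V) : Q.IsAdmissible (Quiver.Path.nil : Quiver.Path u u) :=
  ⟨0, rfl⟩

lemma exists_isAdmissible (u v : V) : ∃ p : Quiver.Path u v, Q.IsAdmissible p := by
  by_cases h : u = v
  · subst h
    exact ⟨.nil, Q.isAdmissible_nil u⟩
  · exact Q.exists_admissible u v h

/-- A chosen admissible path between two vertices. -/
noncomputable def admPath (u v : V) : Quiver.Path u v := (Q.exists_isAdmissible u v).choose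

lemma isAdmissible_admPath (u v : V) : Q.IsAdmissible (Q.admPath u v) :=
  (Q.exists_isAdmissible u v).choose_spec

/-- The type of the admissible paths between two vertices. -/
noncomputable def relType (u v : V) : Fin (n + 1) → ℕ := Q.pathType (Q.admPath u v)

lemma exists_relType_eq_zero (u v : V) : ∃ t, Q.relType u v t = 0 := Q.isAdmissible_admPath u v

lemma pathType_eq_relType {u v : V} {p : Quiver.Path u v} (hp : Q.IsAdmissible p) :
    Q.pathType p = Q.relType u v :=
  (Q.target_eq_iff p (Q.admPath u v) hp (Q.isAdmissible_admPath u v)).1 rfl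

lemma relType_self (u : V) : Q.relType u u = 0 :=
  (Q.pathType_eq_relType (Q.isAdmissible_nil u)).symm

lemma eq_of_relType_eq {u v w : V} (h : Q.relType u v = Q.relType u w) : v = w :=
  (Q.target_eq_iff _ _ (Q.isAdmissible_admPath u v) (Q.isAdmissible_admPath u w)).2 h

lemma relType_eq_zero_iff {u v : V} : Q.relType u v = 0 ↔ u = v := by
  constructor
  · intro h
    exact Q.eq_of_relType_eq ((Q.relType_self u).trans h.symm)
  · rintro rfl
    exact Q.relType_self u

/-- The hypothesis, recurrent below, says that the concatenated path still misses some arrow type,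
that is, stays admissible; types are additive only then. -/
lemma relType_eq_add {u v w : V} (h : ∃ t, Q.relType u v t + Q.relType v w t = 0) :
    Q.relType u w = Q.relType u v + Q.relType v w := by
  have hp : Q.IsAdmissible ((Q.admPath u v).comp (Q.admPath v w)) := by
    obtain ⟨t, ht⟩ := h
    exact ⟨t, by rw [Q.pathType_comp]; exact ht⟩
  rw [← Q.pathType_eq_relType hp, Q.pathType_comp]
  rfl

lemma relType_eq_add_pathType {v u w : V} (p : Quiver.Path u w)
    (h : ∃ t, Q.relType v u t + Q.pathType p t = 0) :
    Q.relType v w = Q.relType v u + Q.pathType p := by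
  rw [← Q.pathType_eq_relType (p := (Q.admPath v u).comp p), Q.pathType_comp]
  · rfl
  · obtain ⟨t, ht⟩ := h
    refine ⟨t, ?_⟩
    rw [Q.pathType_comp, Pi.add_apply]
    exact ht

lemma length_eq_sum_pathType {u v : V} (p : Quiver.Path u v) :
    p.length = ∑ t, Q.pathType p t := by
  induction p with
  | nil => simp [pathType_nil]
  | cons p a ih => simp [pathType_cons, Finset.sum_add_distrib, ih]

/-- If a type were missing, the arrow of that type leaving the end would prolong the simple path. -/
lemma not_isAdmissible_of_isMaximalSimplePath {u v : V} {p : Quiver.Path u v}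
    (hp : Q.IsMaximalSimplePath p) : ¬ Q.IsAdmissible p := by
  rintro ⟨t, ht⟩
  obtain ⟨⟨x, a⟩, ha, -⟩ := Q.existsUnique_arrow v t
  dsimp only at ha
  have := (hp.2 (.nil : Quiver.Path u u) a.toPath fun s => ?_).2
  · exact Nat.succ_ne_zero _ this
  · rw [Quiver.Path.nil_comp, Q.pathType_comp, Quiver.Hom.toPath, pathType_cons, pathType_nil,
      ha, Pi.add_apply, zero_add]
    by_cases hs : s = t
    · rw [hs, ht]; simp
    · have := hp.1 s
      simpa [hs] using this

lemma exists_path_pathType (u : V) (δ : Fin (n + 1) → ℕ) :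
    ∃ (v : V) (p : Quiver.Path u v), Q.pathType p = δ := by
  obtain ⟨s, hs⟩ : ∃ s : Multiset (Fin (n + 1)), ∀ t, s.count t = δ t :=
    ⟨∑ i, δ i • {i}, fun t => by simp [Multiset.count_sum', Multiset.count_singleton]⟩
  refine ⟨_, (Q.pathOfTypes s.toList u).2, funext fun t => ?_⟩
  rw [Q.pathType_pathOfTypes, ← Multiset.coe_count, Multiset.coe_toList, hs]

/-- An admissible path may be reordered so that it ends with any prescribed part of its type. -/
lemma exists_comp_of_le {u v : V} (h : Quiver.Path u v) (hp : Q.IsAdmissible h)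
    (δ : Fin (n + 1) → ℕ) (hδ : δ ≤ Q.pathType h) :
    ∃ (x : V) (q : Quiver.Path u x) (r : Quiver.Path x v),
      Q.pathType q + δ = Q.pathType h ∧ Q.pathType r = δ := by
  obtain ⟨x, q, hq⟩ := Q.exists_path_pathType u (Q.pathType h - δ)
  obtain ⟨y, r, hr⟩ := Q.exists_path_pathType x δ
  have hqr : Q.pathType (q.comp r) = Q.pathType h := by
    rw [Q.pathType_comp, hq, hr, tsub_add_cancel_of_le hδ]
  have hy : v = y := by
    refine (Q.target_eq_iff h (q.comp r) hp ?_).2 hqr.symm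
    obtain ⟨t, ht⟩ := hp
    exact ⟨t, by rw [hqr, ht]⟩
  subst hy
  exact ⟨x, q, r, by rw [hq, tsub_add_cancel_of_le hδ], hr⟩

lemma isMaximalSimplePath_of_pathType_eq_one {u v : V} (p : Quiver.Path u v)
    (hp : ∀ t, Q.pathType p t = 1) : Q.IsMaximalSimplePath p := by
  have length_eq : ∀ {a b : V} (q : Quiver.Path a b), Q.pathType q = 0 → q.length = 0 := by
    intro a b q hq
    simp [Q.length_eq_sum_pathType, hq]
  refine ⟨fun t => (hp t).le, fun q r h => ⟨length_eq q (funext fun t => ?_),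
    length_eq r (funext fun t => ?_)⟩⟩ <;>
  · have := h t
    simp only [pathType_comp, Pi.add_apply, hp] at this
    simp only [Pi.zero_apply]
    omega

lemma eq_of_pathType_eq_one {u v : V} (p : Quiver.Path u v) (hp : ∀ t, Q.pathType p t = 1) :
    u = v :=
  Q.circuit p (Q.isMaximalSimplePath_of_pathType_eq_one p hp)

/-- The end `I · u` of a simple path leaving `u` with essential type `I`. -/
noncomputable def shift (u : V) (I : Finset (Fin (n + 1))) : V := (Q.simplePath u I).1

/-- A simple path leaving `u` with essential type `I`. -/
noncomputable def shiftPath (u : V) (I : Finset (Fin (n + 1))) : Quiver.Path u (Q.shift u I) :=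
  (Q.simplePath u I).2

lemma pathType_shiftPath (u : V) (I : Finset (Fin (n + 1))) :
    Q.pathType (Q.shiftPath u I) = indicatorType I :=
  funext fun t => Q.pathType_simplePath u I t

lemma exists_not_mem {I : Finset (Fin (n + 1))} (hI : I ≠ Finset.univ) : ∃ t, t ∉ I := by
  by_contra! h
  exact hI (Finset.eq_univ_of_forall h)

lemma isAdmissible_shiftPath (u : V) {I : Finset (Fin (n + 1))} (hI : I ≠ Finset.univ) :
    Q.IsAdmissible (Q.shiftPath u I) := by
  obtain ⟨t, ht⟩ := exists_not_mem hI
  exact ⟨t, by simp [pathType_shiftPath, indicatorType, ht]⟩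

lemma relType_shift (u : V) {I : Finset (Fin (n + 1))} (hI : I ≠ Finset.univ) :
    Q.relType u (Q.shift u I) = indicatorType I := by
  rw [← Q.pathType_eq_relType (Q.isAdmissible_shiftPath u hI), pathType_shiftPath]

lemma eq_shift {u v : V} {I : Finset (Fin (n + 1))} (hI : I ≠ Finset.univ)
    (h : Q.relType u v = indicatorType I) : v = Q.shift u I :=
  Q.eq_of_relType_eq (h.trans (Q.relType_shift u hI).symm)

lemma pathType_shiftPath_comp_compl (u : V) (I : Finset (Fin (n + 1))) (t : Fin (n + 1)) :
    Q.pathType ((Q.shiftPath u I).comp (Q.shiftPath (Q.shift u I) Iᶜ)) t = 1 := by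
  rw [pathType_comp, pathType_shiftPath, pathType_shiftPath]
  by_cases h : t ∈ I <;> simp [indicatorType, h]

/-- Both moves together use each arrow type once, hence form a minimal circuit. So `shift w Iᶜ`
serves below as the predecessor `w - I` of `w`. -/
lemma shift_shift_compl (u : V) (I : Finset (Fin (n + 1))) :
    Q.shift (Q.shift u I) Iᶜ = u :=
  (Q.eq_of_pathType_eq_one _ (Q.pathType_shiftPath_comp_compl u I)).symm

lemma shift_compl_shift (u : V) (I : Finset (Fin (n + 1))) :
    Q.shift (Q.shift u Iᶜ) I = u := by
  simpa using Q.shift_shift_compl u Iᶜ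

lemma relType_shift_compl (w : V) {I : Finset (Fin (n + 1))} (hI : I ≠ Finset.univ) :
    Q.relType (Q.shift w Iᶜ) w = indicatorType I := by
  have := Q.relType_shift (Q.shift w Iᶜ) hI
  rwa [shift_compl_shift] at this

lemma areNeighbors_shift (u : V) {I : Finset (Fin (n + 1))} (hI : I ≠ Finset.univ)
    (hI' : I.Nonempty) : Q.AreNeighbors u (Q.shift u I) := by
  refine ⟨fun h => ?_, Q.shiftPath u I, Q.isAdmissible_shiftPath u hI,
    Q.isSimplePath_simplePath u I⟩
  have h1 := Q.relType_shift u hI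
  rw [← h, relType_self] at h1
  obtain ⟨t, ht⟩ := hI'
  simpa [indicatorType, ht] using congrFun h1 t

lemma relType_shift_self (u : V) {I : Finset (Fin (n + 1))} (hI : I.Nonempty) :
    Q.relType (Q.shift u I) u = indicatorType Iᶜ := by
  have := Q.relType_shift_compl u (I := Iᶜ) (by simpa [Finset.nonempty_iff_ne_empty] using hI)
  rwa [compl_compl] at this

lemma AreNeighbors.exists_eq_shift {u v : V} (h : Q.AreNeighbors u v) :
    ∃ I : Finset (Fin (n + 1)), I ≠ Finset.univ ∧ I.Nonempty ∧ v = Q.shift u I := by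
  obtain ⟨hne, p, hp, hs⟩ := h
  have hI : Q.pathType p = indicatorType (Q.essentialType p) := by
    funext t
    have := hs t
    simp only [indicatorType, ArrowPartition.essentialType, Finset.mem_filter, Finset.mem_univ,
      true_and]
    split_ifs <;> omega
  have h1 : Q.essentialType p ≠ Finset.univ := by
    intro h
    obtain ⟨t, ht⟩ := hp
    rw [h] at hI
    rw [hI] at ht
    simp [indicatorType] at ht
  have hrel := (Q.pathType_eq_relType hp).symm.trans hI
  refine ⟨_, h1, ?_, Q.eq_shift h1 hrel⟩
  rw [Finset.nonempty_iff_ne_empty]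
  intro h
  rw [h] at hrel
  exact hne (Q.relType_eq_zero_iff.1 (hrel.trans (by ext; simp [indicatorType])))

/-- The predecessor `w - I` of `w` lies on the way from `v` to `w` if the type from `v` to `w`
contains `I`. -/
lemma relType_shift_compl_add {v w : V} {I : Finset (Fin (n + 1))}
    (h : indicatorType I ≤ Q.relType v w) :
    Q.relType v (Q.shift w Iᶜ) + indicatorType I = Q.relType v w := by
  obtain ⟨x, q, r, hq, hr⟩ := Q.exists_comp_of_le (Q.admPath v w) (Q.isAdmissible_admPath v w) _ h
  obtain ⟨t, ht⟩ := Q.exists_relType_eq_zero v w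
  have h1 := congrFun hq t
  rw [Pi.add_apply] at h1
  change _ = Q.relType v w t at h1
  have hI : I ≠ Finset.univ := by
    rintro rfl
    simp [indicatorType] at h1
    omega
  have hr' : Q.relType x w = indicatorType I := by
    rw [← hr, ← Q.pathType_eq_relType]
    exact ⟨t, by rw [hr]; omega⟩
  have hx : x = Q.shift w Iᶜ := by
    rw [Q.eq_shift hI hr', shift_shift_compl]
  rw [← hx, ← Q.pathType_eq_relType (p := q) ⟨t, by omega⟩]
  exact hq

end ZnQuiver

/-! ### Projectivity of semisimple objects. -/

section Semisimple

variable {A : Type u₂} [Category.{v₂} A] [Abelian A]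

lemma projective_of_isBilimit {m : ℕ} {S : Fin m → A} {b : Bicone S} (hb : b.IsBilimit)
    (hS : ∀ i, Projective (S i)) : Projective b.pt where
  factors f e _ := by
    refine ⟨∑ i, b.π i ≫ Projective.factorThru (b.ι i ≫ f) e, ?_⟩
    simp only [Preadditive.sum_comp, Category.assoc, Projective.factorThru_comp]
    simp only [← Category.assoc, ← Preadditive.sum_comp, IsBilimit.total hb, Category.id_comp]

/-- If all objects are semisimple then simple objects are projective. -/
lemma projective_of_simple (hA : ∀ X : A, IsSemisimpleObject X) (T : A) [Simple T] :
    Projective T where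
  factors {E X} f e _ := by
    let p : pullback f e ⟶ T := pullback.fst f e
    have hp : p ≠ 0 := by
      intro h
      have : Epi p := inferInstanceAs (Epi (pullback.fst f e))
      exact id_nonzero T ((cancel_epi p).1 (by rw [h]; simp))
    obtain ⟨m, S, b, hS, ⟨hb⟩, ⟨i⟩⟩ := hA (pullback f e)
    -- Some simple summand of the pullback maps nontrivially to `T`, hence isomorphically by Schur's
    -- lemma; inverting this and projecting to `E` lifts `f`.
    obtain ⟨j, hj⟩ : ∃ j, (b.ι j ≫ i.inv) ≫ p ≠ 0 := by
      by_contra! h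
      apply hp
      have : i.inv ≫ p = 0 := by
        rw [← Category.id_comp (i.inv ≫ p), ← IsBilimit.total hb, Preadditive.sum_comp]
        exact Finset.sum_eq_zero fun j _ => by simpa using b.π j ≫= h j
      rw [← Iso.hom_inv_id_assoc i p, this, comp_zero]
    have := hS j
    have := isIso_of_hom_simple hj
    refine ⟨inv ((b.ι j ≫ i.inv) ≫ p) ≫ (b.ι j ≫ i.inv) ≫ pullback.snd f e, ?_⟩
    simp only [Category.assoc, ← pullback.condition]
    simp only [IsIso.inv_comp_eq, p, Category.assoc]

lemma projective_of_isSemisimpleObject (hA : ∀ X : A, IsSemisimpleObject X) (X : A) :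
    Projective X := by
  obtain ⟨m, S, b, hS, ⟨hb⟩, ⟨i⟩⟩ := hA X
  exact Projective.of_iso i.symm (projective_of_isBilimit hb fun j =>
    have := hS j
    projective_of_simple hA (S j))

end Semisimple

/-! ### Elements of images and of sums of subobjects. -/

section Elements

variable {A : Type u₂} [Category.{v₂} A] [Abelian A]

lemma imageSubobject_factors_iff {X Y Z : A} [Projective X] (f : Y ⟶ Z) (x : X ⟶ Z) :
    (imageSubobject f).Factors x ↔ ∃ y : X ⟶ Y, y ≫ f = x := by
  constructor
  · intro h
    refine ⟨Projective.factorThru ((imageSubobject f).factorThru x h)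
      (factorThruImageSubobject f), ?_⟩
    refine (congrArg (_ ≫ ·) (imageSubobject_arrow_comp f).symm).trans ?_
    simp only [← Category.assoc, Projective.factorThru_comp, Subobject.factorThru_arrow]
  · rintro ⟨y, rfl⟩
    exact imageSubobject_factors_comp_self f y

/-- The sum is contained in the image of the map from the direct sum of the `P i`, and elements with
projective source lift through an image. -/
lemma exists_eq_sum_of_finset_sup_factors {ι : Type} (s : Finset ι) {X Y : A} [Projective X]
    (P : ι → Subobject Y) (x : X ⟶ Y) (h : (s.sup P).Factors x) :
    ∃ y : ι → (X ⟶ Y), (∀ i ∈ s, (P i).Factors (y i)) ∧ x = ∑ i ∈ s, y i := by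
  classical
  have := HasFiniteBiproducts.of_hasFiniteProducts (C := A)
  let D : (⨁ fun i : s => (P i : A)) ⟶ Y := biproduct.desc fun i => (P i).arrow
  have hle : s.sup P ≤ imageSubobject D := by
    refine Finset.sup_le fun i hi => Subobject.le_of_factors ?_
    have : (P i).arrow = biproduct.ι (fun i : s => (P i : A)) ⟨i, hi⟩ ≫ D := by simp [D]
    rw [this]
    exact imageSubobject_factors_comp_self _ _
  obtain ⟨y, rfl⟩ := (imageSubobject_factors_iff D x).1 (Subobject.factors_of_le x hle h)
  refine ⟨fun i => if hi : i ∈ s then y ≫ biproduct.π (fun i : s => (P i : A)) ⟨i, hi⟩ ≫ (P i).arrow else 0, ?_, ?_⟩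
  · intro i hi
    simp only [hi, dif_pos]
    rw [← Category.assoc]
    exact Subobject.factors_comp_arrow _
  · rw [← Finset.sum_coe_sort s]
    have hD : D = ∑ i : s, biproduct.π (fun i : s => (P i : A)) i ≫ (P i).arrow :=
      biproduct.desc_eq
    simp [hD, Preadditive.comp_sum]

lemma factors_sum {ι : Type*} (s : Finset ι) {X Y : A} (P : Subobject Y) (y : ι → (X ⟶ Y))
    (h : ∀ i ∈ s, P.Factors (y i)) : P.Factors (∑ i ∈ s, y i) := by
  classical
  induction s using Finset.induction_on with
  | empty => simpa using Subobject.factors_zero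
  | insert i t hi ih =>
    rw [Finset.sum_insert hi]
    exact Subobject.factors_add _ _ (h i (Finset.mem_insert_self i t))
      (ih fun j hj => h j (Finset.mem_insert_of_mem hj))

lemma finset_sup_factors_sum {ι : Type*} (s : Finset ι) {X Y : A}
    (P : ι → Subobject Y) (y : ι → (X ⟶ Y)) (h : ∀ i ∈ s, (P i).Factors (y i)) :
    (s.sup P).Factors (∑ i ∈ s, y i) :=
  factors_sum s _ y fun i hi => Subobject.factors_of_le _ (Finset.le_sup hi) (h i hi)

end Elements

/-! ### Kernels of path maps in linked nets. -/

namespace QuiverRep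

variable {k : Type w} [Field k] {n : ℕ} {V : Type u₁} [Quiver.{v₁} V] {Q : ZnQuiver n V}
  {A : Type u₂} [Category.{v₂} A]

lemma pathMap_comp (F : QuiverRep V A) {u v w : V} (p : Quiver.Path u v) (q : Quiver.Path v w) :
    F.pathMap (p.comp q) = F.pathMap p ≫ F.pathMap q :=
  F.map_comp (X := (Paths.of V).obj u) (Y := (Paths.of V).obj v) (Z := (Paths.of V).obj w) p q

lemma pathMap_nil (F : QuiverRep V A) (u : V) :
    F.pathMap (Quiver.Path.nil : Quiver.Path u u) = 𝟙 _ :=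
  F.map_id _

lemma pathMap_cons (F : QuiverRep V A) {u v w : V} (p : Quiver.Path u v) (a : v ⟶ w) :
    F.pathMap (p.cons a) = F.pathMap p ≫ F.pathMap a.toPath :=
  F.pathMap_comp p a.toPath

lemma pathMap_naturality {F F' : QuiverRep V A} (f : F ⟶ F') {u v : V} (p : Quiver.Path u v) :
    F.pathMap p ≫ f.app ((Paths.of V).obj v) = f.app ((Paths.of V).obj u) ≫ F'.pathMap p :=
  f.naturality _

variable (Q) in
/-- The map `φ^u_v` of the chosen admissible path from `u` to `v`. -/
noncomputable def connMap (F : QuiverRep V A) (u v : V) : F.objAt u ⟶ F.objAt v :=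
  F.pathMap (Q.admPath u v)

variable [Abelian A] [Linear k A] {F : QuiverRep V A}

lemma comp_smul_eq_zero_iff {X Y Z : A} {c : k} (hc : c ≠ 0) (x : X ⟶ Y)
    (f : Y ⟶ Z) :
    x ≫ (c • f) = 0 ↔ x ≫ f = 0 := by
  rw [Linear.comp_smul, smul_eq_zero_iff_right hc]

namespace IsWeaklyLinkedNet

variable (h : F.IsWeaklyLinkedNet k Q)
include h

lemma exists_eq_smul {u v : V} {p q : Quiver.Path u v} (hp : Q.IsAdmissible p)
    (hq : Q.IsAdmissible q) : ∃ c : k, c ≠ 0 ∧ F.pathMap p = c • F.pathMap q := by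
  obtain ⟨c, hc⟩ := h.exists_smul p q hq
  obtain ⟨d, hd⟩ := h.exists_smul q p hp
  by_cases h0 : c = 0
  -- Both maps vanish here, so any nonzero scalar will do.
  · refine ⟨1, one_ne_zero, ?_⟩
    rw [h0, zero_smul] at hc
    rw [hd, hc, smul_zero, smul_zero]
  · exact ⟨c, h0, hc⟩

lemma exists_eq_smul_connMap {u v : V} {p : Quiver.Path u v} (hp : Q.IsAdmissible p) :
    ∃ c : k, c ≠ 0 ∧ F.pathMap p = c • F.connMap Q u v :=
  h.exists_eq_smul hp (Q.isAdmissible_admPath u v)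

/-- At the first arrow `a` that destroys admissibility, the path before it contains every type
except that of `a`. Reordered, it ends with one arrow of each of those types, and these together
with `a` form a minimal circuit. -/
lemma pathMap_eq_zero {u v : V} (p : Quiver.Path u v) (hp : ¬ Q.IsAdmissible p) :
    F.pathMap p = 0 := by
  induction p with
  | nil => exact absurd (Q.isAdmissible_nil u) hp
  | @cons v w p a ih =>
    by_cases hp' : Q.IsAdmissible p
    swap
    · rw [pathMap_cons, ih hp', zero_comp]
    have hpos : ∀ t, Q.pathType (p.cons a) t ≠ 0 := fun t ht => hp ⟨t, ht⟩
    set s := Q.arrowType a with hs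
    have hle : ZnQuiver.indicatorType {s}ᶜ ≤ Q.pathType p := by
      intro t
      have := hpos t
      rw [Q.pathType_cons, ← hs] at this
      by_cases hts : t = s
      · simp [ZnQuiver.indicatorType, hts]
      · simp [ZnQuiver.indicatorType, hts] at this ⊢
        omega
    obtain ⟨x, q, r, hq, hr⟩ := Q.exists_comp_of_le p hp' _ hle
    have hqr : Q.IsAdmissible (q.comp r) := by
      obtain ⟨t, ht⟩ := hp'
      exact ⟨t, by rw [Q.pathType_comp, hr, hq, ht]⟩
    obtain ⟨c, -, hc⟩ := h.exists_eq_smul hp' hqr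
    have hra : F.pathMap (r.cons a) = 0 := by
      refine h.map_circuit _ (Q.isMaximalSimplePath_of_pathType_eq_one _ fun t => ?_)
      rw [Q.pathType_cons, hr, ← hs]
      by_cases hts : t = s
      · rw [hts]; simp [ZnQuiver.indicatorType]
      · simp [ZnQuiver.indicatorType, hts]
    rw [pathMap_cons, hc, pathMap_comp, Linear.smul_comp, Category.assoc, ← pathMap_cons, hra,
      comp_zero, smul_zero]

lemma exists_connMap_self (u : V) : ∃ c : k, c ≠ 0 ∧ F.connMap Q u u = c • 𝟙 _ := by
  obtain ⟨c, hc, h1⟩ := h.exists_eq_smul (Q.isAdmissible_admPath u u) (Q.isAdmissible_nil u)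
  exact ⟨c, hc, h1.trans (by rw [pathMap_nil])⟩

lemma exists_connMap_comp {u v w : V} (huv : ∃ t, Q.relType u v t + Q.relType v w t = 0) :
    ∃ c : k, c ≠ 0 ∧ F.connMap Q u v ≫ F.connMap Q v w = c • F.connMap Q u w := by
  rw [connMap, connMap, ← pathMap_comp]
  refine h.exists_eq_smul_connMap ?_
  obtain ⟨t, ht⟩ := huv
  exact ⟨t, by rw [Q.pathType_comp]; exact ht⟩

lemma connMap_comp_eq_zero {u v w : V} (huv : ¬ ∃ t, Q.relType u v t + Q.relType v w t = 0) :
    F.connMap Q u v ≫ F.connMap Q v w = 0 := by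
  rw [connMap, connMap, ← pathMap_comp]
  refine h.pathMap_eq_zero _ fun ⟨t, ht⟩ => huv ⟨t, ?_⟩
  rw [Q.pathType_comp] at ht
  exact ht

lemma comp_pathMap_eq_zero_iff {u v w : V} {p : Quiver.Path u v} {q : Quiver.Path u w}
    (hp : Q.IsAdmissible p) (hpq : Q.pathType p = Q.pathType q) {X : A} (x : X ⟶ F.objAt u) :
    x ≫ F.pathMap p = 0 ↔ x ≫ F.pathMap q = 0 := by
  have hq : Q.IsAdmissible q := by
    obtain ⟨t, ht⟩ := hp
    exact ⟨t, by rw [← hpq, ht]⟩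
  have := (Q.target_eq_iff p q hp hq).2 hpq
  subst this
  obtain ⟨c, hc, h1⟩ := h.exists_eq_smul hp hq
  rw [h1, comp_smul_eq_zero_iff hc]

lemma comp_pathMap_eq_zero_iff_connMap {u v : V} {p : Quiver.Path u v}
    (hp : Q.IsAdmissible p) {X : A} (x : X ⟶ F.objAt u) :
    x ≫ F.pathMap p = 0 ↔ x ≫ F.connMap Q u v = 0 :=
  h.comp_pathMap_eq_zero_iff hp (Q.pathType_eq_relType hp) x

lemma pathMap_shiftPath_univ (u : V) : F.pathMap (Q.shiftPath u Finset.univ) = 0 :=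
  h.pathMap_eq_zero _ fun ⟨t, ht⟩ => by
    simp [Q.pathType_shiftPath, ZnQuiver.indicatorType] at ht

lemma comp_shiftPath_comp_sdiff_eq_zero_iff (u : V) {I J : Finset (Fin (n + 1))} (hJI : J ⊆ I)
    (hI : I ≠ Finset.univ) {X : A} (x : X ⟶ F.objAt u) :
    (x ≫ F.pathMap (Q.shiftPath u J)) ≫ F.pathMap (Q.shiftPath (Q.shift u J) (I \ J)) = 0 ↔
      x ≫ F.pathMap (Q.shiftPath u I) = 0 := by
  rw [Category.assoc, ← pathMap_comp]
  refine (h.comp_pathMap_eq_zero_iff (Q.isAdmissible_shiftPath u hI) ?_ x).symm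
  rw [Q.pathType_comp, Q.pathType_shiftPath, Q.pathType_shiftPath, Q.pathType_shiftPath]
  funext t
  by_cases h1 : t ∈ J
  · simp [ZnQuiver.indicatorType, h1, hJI h1]
  · simp [ZnQuiver.indicatorType, h1]

lemma comp_shiftPath_eq_zero_of_subset (u : V) {I J : Finset (Fin (n + 1))} (hJI : J ⊆ I)
    {X : A} (x : X ⟶ F.objAt u) (hx : x ≫ F.pathMap (Q.shiftPath u J) = 0) :
    x ≫ F.pathMap (Q.shiftPath u I) = 0 := by
  by_cases hI : I = Finset.univ
  · rw [hI, h.pathMap_shiftPath_univ, comp_zero]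
  · rw [← h.comp_shiftPath_comp_sdiff_eq_zero_iff u hJI hI, hx, zero_comp]

end IsWeaklyLinkedNet

namespace IsLinkedNet

variable (h : F.IsLinkedNet k Q)
include h

lemma eq_zero_of_comp_eq_zero {u v w : V} {p : Quiver.Path u v} {q : Quiver.Path u w}
    (hp : Q.IsAdmissible p) (hq : Q.IsAdmissible q)
    (hpq : ∀ t, Q.pathType p t = 0 ∨ Q.pathType q t = 0) {X : A} {x : X ⟶ F.objAt u}
    (hxp : x ≫ F.pathMap p = 0) (hxq : x ≫ F.pathMap q = 0) : x = 0 := by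
  have hd : Disjoint (Q.essentialType p) (Q.essentialType q) := by
    rw [Finset.disjoint_left]
    intro t h1 h2
    simp only [ArrowPartition.essentialType, Finset.mem_filter, Finset.mem_univ, true_and] at h1 h2
    have := hpq t
    omega
  rw [← Subobject.bot_factors_iff_zero, ← h.ker_inf_ker p q hp hq hd, Subobject.inf_factors]
  exact ⟨kernelSubobject_factors _ _ hxp, kernelSubobject_factors _ _ hxq⟩

/-- The image of `x` along `I ∩ J` is killed by the paths of types `I \ J` and `J \ I`, which share
no arrow type; condition (3) makes it zero. -/
lemma comp_shiftPath_inter_eq_zero (u : V) (I J : Finset (Fin (n + 1))) {X : A}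
    (x : X ⟶ F.objAt u) (hI : x ≫ F.pathMap (Q.shiftPath u I) = 0)
    (hJ : x ≫ F.pathMap (Q.shiftPath u J) = 0) :
    x ≫ F.pathMap (Q.shiftPath u (I ∩ J)) = 0 := by
  by_cases hI' : I = Finset.univ
  · rwa [hI', Finset.univ_inter]
  by_cases hJ' : J = Finset.univ
  · rwa [hJ', Finset.inter_univ]
  have hIJ : I \ (I ∩ J) ≠ Finset.univ := fun h' =>
    hI' (Finset.univ_subset_iff.1 (h' ▸ Finset.sdiff_subset))
  have hJI : J \ (I ∩ J) ≠ Finset.univ := fun h' =>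
    hJ' (Finset.univ_subset_iff.1 (h' ▸ Finset.sdiff_subset))
  refine h.eq_zero_of_comp_eq_zero (Q.isAdmissible_shiftPath _ hIJ)
    (Q.isAdmissible_shiftPath _ hJI) (fun t => ?_)
    ((h.comp_shiftPath_comp_sdiff_eq_zero_iff u Finset.inter_subset_left hI' x).2 hI)
    ((h.comp_shiftPath_comp_sdiff_eq_zero_iff u Finset.inter_subset_right hJ' x).2 hJ)
  rw [Q.pathType_shiftPath, Q.pathType_shiftPath]
  by_cases h1 : t ∈ I <;> by_cases h2 : t ∈ J <;> simp [ZnQuiver.indicatorType, h1, h2]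

/-- The kernel of the map of a path without arrows of type `t` is contained in that of a simple
path with all the other arrow types. -/
lemma comp_shiftPath_compl_singleton_eq_zero {u v : V} (p : Quiver.Path u v) (t : Fin (n + 1))
    (hp : Q.pathType p t = 0) {X : A} (x : X ⟶ F.objAt u) (hx : x ≫ F.pathMap p = 0) :
    x ≫ F.pathMap (Q.shiftPath u {t}ᶜ) = 0 := by
  have hne : ∀ s : Fin (n + 1), ({s}ᶜ : Finset (Fin (n + 1))) ≠ Finset.univ := fun s hs => by
    have := Finset.mem_univ s
    rw [← hs] at this
    simp at this
  suffices H : (x ≫ F.pathMap p) ≫ F.pathMap (Q.shiftPath v {t}ᶜ) = 0 →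
      x ≫ F.pathMap (Q.shiftPath u {t}ᶜ) = 0 from H (by rw [hx, zero_comp])
  clear hx
  induction p with
  | nil => rw [pathMap_nil, Category.comp_id]; exact id
  | @cons v w p a ih =>
    rw [Q.pathType_cons, Pi.add_apply, Nat.add_eq_zero_iff] at hp
    have hat : t ≠ Q.arrowType a := by
      intro hat
      have := hp.2
      rw [hat] at this
      simp at this
    intro hx
    refine ih hp.1 ?_
    set y := x ≫ F.pathMap p
    obtain ⟨b, hb⟩ := Q.existsUnique_arrow (Q.shift v {t}ᶜ) (Q.arrowType a)
    obtain ⟨e, he⟩ := Q.existsUnique_arrow (Q.shift v {t}ᶜ) t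
    have hb1 := hb.1
    have he1 := he.1
    dsimp only at hb1 he1
    have htype : ∀ {y z : V} (a : y ⟶ z), Q.pathType a.toPath = Pi.single (Q.arrowType a) 1 :=
      fun a => by rw [Quiver.Hom.toPath, Q.pathType_cons, Q.pathType_nil, zero_add]
    -- The image of `y` along `{t}ᶜ` is killed by the next arrow of the type of `a`, by reordering
    -- `hx`, and by that of type `t`, which completes a circuit. The two types differ, so condition
    -- (3) applies.
    refine h.eq_zero_of_comp_eq_zero (p := b.2.toPath) (q := e.2.toPath) ⟨t, ?_⟩
      ⟨Q.arrowType a, ?_⟩ (fun s => ?_) ?_ ?_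
    · rw [htype, hb1]; simp [hat]
    · rw [htype, he1]; simp [hat.symm]
    · rw [htype, htype, hb1, he1]
      by_cases hs : s = t
      · left; rw [hs]; simp [hat]
      · right; simp [hs]
    · rw [pathMap_cons, ← Category.assoc, Category.assoc, ← pathMap_comp] at hx
      rw [Category.assoc, ← pathMap_comp]
      refine (h.comp_pathMap_eq_zero_iff (p := a.toPath.comp (Q.shiftPath w {t}ᶜ)) ?_ ?_ y).1 hx
      · refine ⟨t, ?_⟩
        rw [Q.pathType_comp, htype, Q.pathType_shiftPath]
        simp [ZnQuiver.indicatorType, hat]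
      · rw [Q.pathType_comp, Q.pathType_comp, htype, htype, hb1, Q.pathType_shiftPath,
          Q.pathType_shiftPath]
        exact add_comm _ _
    · rw [Category.assoc, ← pathMap_comp, h.pathMap_eq_zero, comp_zero]
      rintro ⟨s, hs⟩
      rw [Q.pathType_comp, htype, he1, Q.pathType_shiftPath] at hs
      by_cases hst : s = t
      · simp [hst] at hs
      · simp [ZnQuiver.indicatorType, hst] at hs

end IsLinkedNet

lemma kerOfTypes_factors_iff {v : V} {I : Finset (Fin (n + 1))} {X : A} (x : X ⟶ F.objAt v) :
    (F.kerOfTypes Q v I).Factors x ↔ x ≫ F.pathMap (Q.shiftPath v I) = 0 :=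
  kernelSubobject_factors_iff _ _

lemma IsExact.comp_connMap_eq_zero_iff (hF : F.IsExact Q) {u v : V} (huv : Q.AreNeighbors u v)
    {X : A} [Projective X] (x : X ⟶ F.objAt u) :
    x ≫ F.connMap Q u v = 0 ↔ ∃ y : X ⟶ F.objAt v, y ≫ F.connMap Q v u = x := by
  rw [← imageSubobject_factors_iff, ← kernelSubobject_factors_iff]
  have := hF huv _ _ (Q.isAdmissible_admPath u v) (Q.isAdmissible_admPath v u)
  rw [connMap, connMap, this]

end QuiverRep

/-! ### Nets generated by an object at a vertex. -/

namespace QuiverRep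

variable {k : Type w} [Field k] {n : ℕ} {V : Type u₁} [Quiver.{v₁} V] {Q : ZnQuiver n V}
  {A : Type u₂} [Category.{v₂} A] [Abelian A] [Linear k A]

open Classical in
variable (Q) in
/-- The representation with the object `S` at each vertex, where an arrow acts by a given scalar
if it prolongs an admissible path leaving `v` to an admissible path, and by zero otherwise. -/
noncomputable def genNet (v : V) (S : A) (c : ∀ u w : V, (u ⟶ w) → k) : QuiverRep V A :=
  Paths.lift
    { obj := fun _ => S
      map := fun {u w} a =>
        if ∃ t, Q.relType v u t + (Pi.single (Q.arrowType a) 1 : Fin (n + 1) → ℕ) t = 0 then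
          c u w a • 𝟙 S else 0 }

section genNet

variable {v : V} {S : A} {c : ∀ u w : V, (u ⟶ w) → k}

variable (Q v S c) in
/-- The identification of the objects of `genNet Q v S c` with `S`. -/
noncomputable def genNetIso (u : V) : (genNet Q v S c).objAt u ≅ S := Iso.refl S

lemma genNet_toPath {u w : V} (a : u ⟶ w)
    (h : ∃ t, Q.relType v u t + (Pi.single (Q.arrowType a) 1 : Fin (n + 1) → ℕ) t = 0) :
    (genNet Q v S c).pathMap a.toPath =
      c u w a • ((genNetIso Q v S c u).hom ≫ (genNetIso Q v S c w).inv) := by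
  refine (Paths.lift_toPath _ a).trans ((if_pos h).trans ?_)
  exact congrArg (c u w a • ·) (Category.id_comp (𝟙 S)).symm

lemma genNet_toPath_eq_zero {u w : V} (a : u ⟶ w)
    (h : ¬ ∃ t, Q.relType v u t + (Pi.single (Q.arrowType a) 1 : Fin (n + 1) → ℕ) t = 0) :
    (genNet Q v S c).pathMap a.toPath = 0 :=
  (Paths.lift_toPath _ a).trans (if_neg h)

lemma genNet_pathMap (hc : ∀ u w a, c u w a ≠ 0) {u w : V} (p : Quiver.Path u w)
    (h : ∃ t, Q.relType v u t + Q.pathType p t = 0) :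
    ∃ d : k, d ≠ 0 ∧ (genNet Q v S c).pathMap p =
      d • ((genNetIso Q v S c u).hom ≫ (genNetIso Q v S c w).inv) := by
  induction p with
  | nil => exact ⟨1, one_ne_zero, by rw [pathMap_nil, one_smul, Iso.hom_inv_id]⟩
  | @cons w x p a ih =>
    obtain ⟨t, ht⟩ := h
    rw [Q.pathType_cons, Pi.add_apply, ← add_assoc] at ht
    obtain ⟨d, hd, h1⟩ := ih ⟨t, by omega⟩
    have hw := Q.relType_eq_add_pathType (v := v) p ⟨t, by omega⟩
    rw [pathMap_cons, h1, genNet_toPath a ⟨t, by rw [hw]; exact ht⟩]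
    refine ⟨d * c w x a, mul_ne_zero hd (hc _ _ _), ?_⟩
    rw [Linear.smul_comp, Linear.comp_smul, smul_smul, Category.assoc, Iso.inv_hom_id_assoc]

lemma genNet_pathMap_eq_zero {u w : V} (p : Quiver.Path u w)
    (h : ¬ ∃ t, Q.relType v u t + Q.pathType p t = 0) :
    (genNet Q v S c).pathMap p = 0 := by
  induction p with
  | nil =>
    obtain ⟨t, ht⟩ := Q.exists_relType_eq_zero v u
    exact absurd ⟨t, by rw [ht, Q.pathType_nil]; rfl⟩ h
  | @cons w x p a ih =>
    rw [pathMap_cons]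
    by_cases h' : ∃ t, Q.relType v u t + Q.pathType p t = 0
    · have hw := Q.relType_eq_add_pathType p h'
      rw [genNet_toPath_eq_zero, comp_zero]
      rintro ⟨s, hs⟩
      exact h ⟨s, by rw [Q.pathType_cons, Pi.add_apply, ← add_assoc]; rwa [hw] at hs⟩
    · rw [ih h', zero_comp]

lemma isIso_genNet_pathMap (hc : ∀ u w a, c u w a ≠ 0) {u w : V} (p : Quiver.Path u w)
    (h : ∃ t, Q.relType v u t + Q.pathType p t = 0) :
    IsIso ((genNet Q v S c).pathMap p) := by
  obtain ⟨d, hd, h1⟩ := genNet_pathMap (S := S) hc p h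
  rw [h1]
  exact ⟨d⁻¹ • ((genNetIso Q v S c w).hom ≫ (genNetIso Q v S c u).inv),
    by simp [smul_smul, hd], by simp [smul_smul, hd]⟩

lemma isWeaklyLinkedNet_genNet (hc : ∀ u w a, c u w a ≠ 0) :
    (genNet Q v S c).IsWeaklyLinkedNet k Q where
  exists_smul {u w} p q hq := by
    by_cases h : ∃ t, Q.relType v u t + Q.pathType p t = 0
    · obtain ⟨d, hd, h1⟩ := genNet_pathMap (S := S) hc p h
      have hp : Q.IsAdmissible p := by
        obtain ⟨t, ht⟩ := h
        exact ⟨t, by omega⟩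
      rw [Q.pathType_eq_relType hp, ← Q.pathType_eq_relType hq] at h
      obtain ⟨e, he, h2⟩ := genNet_pathMap (S := S) hc q h
      exact ⟨d * e⁻¹, by rw [h1, h2, smul_smul, mul_assoc, inv_mul_cancel₀ he, mul_one]⟩
    · exact ⟨0, by rw [genNet_pathMap_eq_zero p h, zero_smul]⟩
  map_circuit p hp := genNet_pathMap_eq_zero p fun ⟨t, ht⟩ =>
    Q.not_isAdmissible_of_isMaximalSimplePath hp ⟨t, by omega⟩

/-- A type missing on the way from `v` to `u` is absent from one of the two paths as well; along
that path the map is invertible. -/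
lemma isLinkedNet_genNet (hc : ∀ u w a, c u w a ≠ 0) :
    (genNet Q v S c).IsLinkedNet k Q where
  toIsWeaklyLinkedNet := isWeaklyLinkedNet_genNet hc
  ker_inf_ker {u x y} p q hp hq hpq := by
    rw [eq_bot_iff]
    refine Subobject.le_of_factors ((Subobject.bot_factors_iff_zero _).2 ?_)
    have h1 := (kernelSubobject_factors_iff _ _).1 (Subobject.inf_arrow_factors_left
      (kernelSubobject ((genNet Q v S c).pathMap p)) (kernelSubobject ((genNet Q v S c).pathMap q)))
    have h2 := (kernelSubobject_factors_iff _ _).1 (Subobject.inf_arrow_factors_right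
      (kernelSubobject ((genNet Q v S c).pathMap p)) (kernelSubobject ((genNet Q v S c).pathMap q)))
    obtain ⟨t, ht⟩ := Q.exists_relType_eq_zero v u
    have : Q.pathType p t = 0 ∨ Q.pathType q t = 0 := by
      by_contra! h
      have h1 : t ∈ Q.essentialType p := by
        simpa [ArrowPartition.essentialType, Nat.pos_iff_ne_zero] using h.1
      have h2 : t ∈ Q.essentialType q := by
        simpa [ArrowPartition.essentialType, Nat.pos_iff_ne_zero] using h.2
      exact Finset.disjoint_left.1 hpq h1 h2
    rcases this with h | h
    · have := isIso_genNet_pathMap (Q := Q) (S := S) (v := v) hc p ⟨t, by omega⟩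
      exact (cancel_mono ((genNet Q v S c).pathMap p)).1 (h1.trans zero_comp.symm)
    · have := isIso_genNet_pathMap (Q := Q) (S := S) (v := v) hc q ⟨t, by omega⟩
      exact (cancel_mono ((genNet Q v S c).pathMap q)).1 (h2.trans zero_comp.symm)

/-- Between neighbors one direction is invertible and the other zero. If `p` does not prolong the
way from `v` to `u₁` admissibly, that way contains all types outside `I`, so it can be taken through
`I · u₁` and ends with the type of `q`. -/
lemma isExact_genNet (hc : ∀ u w a, c u w a ≠ 0) : (genNet Q v S c).IsExact Q := by
  intro u₁ u₂ hu p q hp hq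
  obtain ⟨I, hI, hI', rfl⟩ := ZnQuiver.AreNeighbors.exists_eq_shift Q hu
  have hp' := (Q.pathType_eq_relType hp).trans (Q.relType_shift u₁ hI)
  have hq' := (Q.pathType_eq_relType hq).trans (Q.relType_shift_self u₁ hI')
  by_cases h : ∃ t, Q.relType v u₁ t + Q.pathType p t = 0
  · have := isIso_genNet_pathMap (S := S) hc p h
    have hzero : (genNet Q v S c).pathMap q = 0 := genNet_pathMap_eq_zero q fun ⟨t, ht⟩ => by
      rw [Q.relType_eq_add_pathType p h, hp', hq'] at ht
      by_cases h : t ∈ I <;> simp [ZnQuiver.indicatorType, h] at ht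
    simp only [hzero, imageSubobject_zero, eq_bot_iff]
    exact Subobject.le_of_factors ((Subobject.bot_factors_iff_zero _).2
      ((cancel_mono ((genNet Q v S c).pathMap p)).1
        ((kernelSubobject_arrow_comp _).trans zero_comp.symm)))
  · have h2 := Q.relType_shift_compl_add (v := v) (w := u₁) (I := Iᶜ) (by
      intro t
      by_cases htI : t ∈ I
      · simp [ZnQuiver.indicatorType, htI]
      · have : Q.relType v u₁ t ≠ 0 := fun h0 => h ⟨t, by
          rw [h0, hp']; simp [ZnQuiver.indicatorType, htI]⟩
        simp only [ZnQuiver.indicatorType, Finset.mem_compl, htI, not_false_iff, if_true]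
        omega)
    rw [compl_compl] at h2
    have := isIso_genNet_pathMap (S := S) (v := v) hc q (by
      obtain ⟨t, ht⟩ := Q.exists_relType_eq_zero v u₁
      refine ⟨t, ?_⟩
      rw [hq', ← ht, ← h2, Pi.add_apply])
    simp only [genNet_pathMap_eq_zero p h, kernelSubobject_zero]
    rw [imageSubobject_mono]
    exact (Subobject.isIso_iff_mk_eq_top _).1 this |>.symm

/-- A path arriving at `w` with nonzero map is a final piece of an admissible path from `v`, whose
length is determined by `w`. -/
lemma isLocallyFinite_genNet : (genNet Q v S c).IsLocallyFinite := by
  intro w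
  refine ⟨∑ t, Q.relType v w t, fun {u} p hp => genNet_pathMap_eq_zero p fun h => ?_⟩
  rw [Q.relType_eq_add_pathType p h, Q.length_eq_sum_pathType] at hp
  simp only [Pi.add_apply, Finset.sum_add_distrib] at hp
  omega

lemma isLocallyFiniteExactLinkedNet_genNet (hc : ∀ u w a, c u w a ≠ 0) :
    isLocallyFiniteExactLinkedNet k Q A (genNet Q v S c) :=
  ⟨isLinkedNet_genNet hc, isExact_genNet hc, isLocallyFinite_genNet⟩

end genNet

/-- A morphism from `S` to the object at `v` of a weakly linked net extends to a morphism from a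
net generated by `S` at `v`. -/
lemma IsWeaklyLinkedNet.exists_hom_genNet {F : QuiverRep V A} (h : F.IsWeaklyLinkedNet k Q)
    {v : V} {S : A} (f : S ⟶ F.objAt v) :
    ∃ (c : ∀ u w : V, (u ⟶ w) → k) (_ : ∀ u w a, c u w a ≠ 0) (g : genNet Q v S c ⟶ F),
      ∀ w : V, g.app ((Paths.of V).obj w) = (genNetIso Q v S c w).hom ≫ f ≫ F.connMap Q v w := by
  -- The scalars measure how far the chosen admissible paths are from compatible with prolongation
  -- by an arrow. Where this is meaningless the value `1` keeps them all nonzero, as `genNet` needs.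
  have key : ∀ (u w : V) (a : u ⟶ w), ∃ c : k, c ≠ 0 ∧ (Q.IsAdmissible ((Q.admPath v u).cons a) →
      F.pathMap ((Q.admPath v u).cons a) = c • F.connMap Q v w) := by
    intro u w a
    by_cases ha : Q.IsAdmissible ((Q.admPath v u).cons a)
    · obtain ⟨c, hc, h1⟩ := h.exists_eq_smul_connMap ha
      exact ⟨c, hc, fun _ => h1⟩
    · exact ⟨1, one_ne_zero, fun ha' => absurd ha' ha⟩
  choose c hc hc' using key
  refine ⟨c, hc, Paths.liftNatTrans
    (fun w => (genNetIso Q v S c w).hom ≫ f ≫ F.connMap Q v w) fun {u w} a => ?_, fun w => rfl⟩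
  change (genNet Q v S c).pathMap a.toPath ≫ (genNetIso Q v S c w).hom ≫ f ≫ F.connMap Q v w =
    ((genNetIso Q v S c u).hom ≫ f ≫ F.connMap Q v u) ≫ F.pathMap a.toPath
  have hcons : F.connMap Q v u ≫ F.pathMap a.toPath = F.pathMap ((Q.admPath v u).cons a) :=
    (pathMap_cons _ _ _).symm
  simp only [Category.assoc, hcons]
  by_cases ha : ∃ t, Q.relType v u t + (Pi.single (Q.arrowType a) 1 : Fin (n + 1) → ℕ) t = 0
  · rw [genNet_toPath a ha, hc' u w a ha]
    simp
  · rw [genNet_toPath_eq_zero a ha, h.pathMap_eq_zero ((Q.admPath v u).cons a) ha]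
    simp

end QuiverRep

/-! ### Monomorphisms and isomorphisms at the vertices. -/

section Mono

variable {k : Type w} [Field k] {n : ℕ} {V : Type u₁} [Quiver.{v₁} V] {Q : ZnQuiver n V}
  {A : Type u₂} [Category.{v₂} A] [Abelian A] [Linear k A]

open QuiverRep

/-- Monomorphisms of `𝒞_Q(A)` are monomorphisms at each vertex. -/
lemma LinkedNetCat.mono_app {𝔚 𝔙 : LinkedNetCat k Q A} (f : 𝔚 ⟶ 𝔙) [Mono f] (v : V) :
    Mono (f.hom.app ((Paths.of V).obj v)) := by
  refine Preadditive.mono_of_cancel_zero _ fun {S} x hx => ?_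
  have h𝔚 := 𝔚.property.1.toIsWeaklyLinkedNet
  -- An element killed at `v` extends to a map of nets killed by `f`; this map is then zero, and so
  -- is its value at `v`, which is `x` up to a nonzero scalar.
  obtain ⟨c, hc, g, hg⟩ := h𝔚.exists_hom_genNet (v := v) x
  let 𝔓 : LinkedNetCat k Q A := ⟨genNet Q v S c, isLocallyFiniteExactLinkedNet_genNet hc⟩
  let g' : 𝔓 ⟶ 𝔚 := ObjectProperty.homMk g
  have hgf : g' ≫ f = 0 := by
    refine ObjectProperty.hom_ext _ (NatTrans.ext (funext fun (w : V) => ?_))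
    change g.app ((Paths.of V).obj w) ≫ f.hom.app ((Paths.of V).obj w) = 0
    have hnat : 𝔚.obj.connMap Q v w ≫ f.hom.app ((Paths.of V).obj w) =
        f.hom.app ((Paths.of V).obj v) ≫ 𝔙.obj.connMap Q v w := f.hom.naturality _
    rw [hg, Category.assoc, Category.assoc, hnat, reassoc_of% hx, zero_comp, comp_zero]
  have hg0 : g = 0 := congrArg (fun e => e.hom) ((cancel_mono f).1 (hgf.trans zero_comp.symm))
  have h1 := hg v
  rw [hg0] at h1
  obtain ⟨d, hd, h2⟩ := h𝔚.exists_connMap_self v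
  rw [h2] at h1
  have h3 : (genNetIso Q v S c v).inv ≫ ((genNetIso Q v S c v).hom ≫ x ≫ (d • 𝟙 _)) = 0 := by
    rw [← h1]
    exact comp_zero
  rw [Iso.inv_hom_id_assoc, comp_smul_eq_zero_iff hd, Category.comp_id] at h3
  exact h3

lemma LinkedNetCat.mono_of_mono_app {𝔚 𝔙 : LinkedNetCat k Q A} (f : 𝔚 ⟶ 𝔙)
    (h : ∀ v : V, Mono (f.hom.app ((Paths.of V).obj v))) : Mono f := by
  have : Mono f.hom := by
    have : ∀ X, Mono (f.hom.app X) := h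
    exact NatTrans.mono_of_mono_app _
  exact (isLocallyFiniteExactLinkedNet k Q A).ι.mono_of_mono_map this

lemma LinkedNetCat.isIso_of_isIso_app {𝔚 𝔙 : LinkedNetCat k Q A} (f : 𝔚 ⟶ 𝔙)
    (h : ∀ v : V, IsIso (f.hom.app ((Paths.of V).obj v))) : IsIso f := by
  have : ∀ X, IsIso (f.hom.app X) := h
  exact (ObjectProperty.isIso_hom_iff f).1 (NatIso.isIso_of_isIso_app f.hom)

end Mono

/-! ### Generators of an exact net. -/

namespace QuiverRep

variable {k : Type w} [Field k] {n : ℕ} {V : Type u₁} [Quiver.{v₁} V] {Q : ZnQuiver n V}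
  {A : Type u₂} [Category.{v₂} A] [Abelian A] [Linear k A]

lemma IsWeaklyLinkedNet.exists_connMap_eq {F : QuiverRep V A} (h : F.IsWeaklyLinkedNet k Q)
    {v w : V} {I : Finset (Fin (n + 1))} (hI : I ≠ Finset.univ)
    (hle : ZnQuiver.indicatorType I ≤ Q.relType v w) :
    ∃ c : k, c ≠ 0 ∧ F.connMap Q v w =
      c • (F.connMap Q v (Q.shift w Iᶜ) ≫ F.connMap Q (Q.shift w Iᶜ) w) := by
  obtain ⟨t, ht⟩ := Q.exists_relType_eq_zero v w
  have h1 := Q.relType_shift_compl_add hle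
  have h2 := congrFun h1 t
  rw [Pi.add_apply, ht, ← Q.relType_shift_compl w hI] at h2
  obtain ⟨c, hc, h3⟩ := h.exists_connMap_comp ⟨t, h2⟩
  exact ⟨c⁻¹, inv_ne_zero hc, by rw [h3, smul_smul, inv_mul_cancel₀ hc, one_smul]⟩

section Exact

variable [hP : ∀ X : A, Projective X] {F : QuiverRep V A} (hE : F.IsExact Q)
include hE

/-- Along an arrow into a zero object the kernel is everything, yet by exactness it is an image of
zero. So vanishing propagates backwards along paths, and paths join all vertices. -/
lemma IsExact.isZero_of_isZero {u v : V} (hv : IsZero (F.objAt v)) : IsZero (F.objAt u) := by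
  have key : ∀ {u v : V} (p : Quiver.Path u v), IsZero (F.objAt v) → IsZero (F.objAt u) := by
    intro u v p
    induction p with
    | nil => exact id
    | @cons v x p a ih =>
      intro hx
      refine ih ?_
      have ht : Q.pathType a.toPath = Pi.single (Q.arrowType a) 1 := by
        rw [Quiver.Hom.toPath, Q.pathType_cons, Q.pathType_nil, zero_add]
      have ha : Q.IsAdmissible a.toPath := by
        have := Q.n_pos
        have : Nontrivial (Fin (n + 1)) := Fin.nontrivial_iff_two_le.2 (by omega)
        obtain ⟨s, hs⟩ := exists_ne (Q.arrowType a)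
        exact ⟨s, by rw [ht]; simp [hs]⟩
      have hne : v ≠ x := by
        rintro rfl
        have := (Q.pathType_eq_relType ha).trans (Q.relType_self v)
        rw [ht] at this
        simpa using congrFun this (Q.arrowType a)
      have hvx : Q.AreNeighbors v x := ⟨hne, a.toPath, ha, fun t => by
        rw [ht, Pi.single_apply]; split_ifs <;> simp⟩
      obtain ⟨y, hy⟩ := (hE.comp_connMap_eq_zero_iff hvx (𝟙 _)).1 (hx.eq_of_tgt _ _)
      rw [IsZero.iff_id_eq_zero, ← hy, hx.eq_of_tgt y 0, zero_comp]
  exact key (Q.admPath u v) hv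

end Exact

variable (Q) in
/-- A choice of complements `obj v` in `V_v` of the sums of the images of the arrows arriving at
`v`. -/
structure Generators (F : QuiverRep V A) where
  obj : V → A
  incl : ∀ v, obj v ⟶ F.objAt v
  proj : ∀ v, F.objAt v ⟶ obj v
  incl_proj : ∀ v, incl v ≫ proj v = 𝟙 _
  connMap_proj : ∀ v t, F.connMap Q (Q.shift v {t}ᶜ) v ≫ proj v = 0
  exists_eq_sum : ∀ (v : V) {X : A} (x : X ⟶ F.objAt v), x ≫ proj v = 0 →
    ∃ y : ∀ t : Fin (n + 1), X ⟶ F.objAt (Q.shift v {t}ᶜ),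
      x = ∑ t, y t ≫ F.connMap Q (Q.shift v {t}ᶜ) v

/-- The generators are the cokernels of the sums of the incoming arrows, split by projectivity. -/
lemma nonempty_generators [hP : ∀ X : A, Projective X] (F : QuiverRep V A) :
    Nonempty (Generators Q F) := by
  classical
  have := HasFiniteBiproducts.of_hasFiniteProducts (C := A)
  let D (v : V) : (⨁ fun t : Fin (n + 1) => F.objAt (Q.shift v {t}ᶜ)) ⟶ F.objAt v :=
    biproduct.desc fun t => F.connMap Q (Q.shift v {t}ᶜ) v
  refine ⟨⟨fun v => cokernel (D v), fun v => Projective.factorThru (𝟙 _) (cokernel.π (D v)),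
    fun v => cokernel.π (D v), fun v => Projective.factorThru_comp _ _, fun v t => ?_,
    fun v X x hx => ?_⟩⟩
  · have : F.connMap Q (Q.shift v {t}ᶜ) v =
        biproduct.ι (fun t : Fin (n + 1) => F.objAt (Q.shift v {t}ᶜ)) t ≫ D v := by simp [D]
    rw [this, Category.assoc, cokernel.condition, comp_zero]
  · have hex : (ShortComplex.mk (D v) (cokernel.π (D v)) (cokernel.condition _)).Exact :=
      ShortComplex.exact_cokernel _
    obtain ⟨z, hz⟩ : ∃ z : X ⟶ ⨁ fun t : Fin (n + 1) => F.objAt (Q.shift v {t}ᶜ),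
        z ≫ D v = x := ⟨hex.liftFromProjective x hx, hex.liftFromProjective_comp x hx⟩
    refine ⟨fun t => z ≫ biproduct.π _ t, ?_⟩
    have hD : D v = ∑ t, biproduct.π (fun t : Fin (n + 1) => F.objAt (Q.shift v {t}ᶜ)) t ≫
        F.connMap Q (Q.shift v {t}ᶜ) v := biproduct.desc_eq
    rw [← hz, hD, Preadditive.comp_sum]
    simp

lemma singleton_ne_univ (Q : ZnQuiver n V) (t : Fin (n + 1)) :
    ({t} : Finset (Fin (n + 1))) ≠ Finset.univ := by
  intro h
  have := congrArg Finset.card h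
  have := Q.n_pos
  simp at *
  omega

namespace Generators

variable {F : QuiverRep V A} (G : Generators Q F)

lemma connMap_comp_proj (h : F.IsWeaklyLinkedNet k Q) {u w : V} (huw : u ≠ w) :
    F.connMap Q u w ≫ G.proj w = 0 := by
  obtain ⟨t, ht⟩ : ∃ t, Q.relType u w t ≠ 0 := by
    by_contra! h0
    exact huw (Q.relType_eq_zero_iff.1 (funext h0))
  have hle : ZnQuiver.indicatorType {t} ≤ Q.relType u w := by
    intro s
    by_cases hs : s = t
    · subst hs
      simpa [ZnQuiver.indicatorType, Nat.one_le_iff_ne_zero] using ht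
    · simp [ZnQuiver.indicatorType, hs]
  obtain ⟨c, -, hc⟩ := h.exists_connMap_eq (singleton_ne_univ Q t) hle
  rw [hc, Linear.smul_comp, Category.assoc, G.connMap_proj, comp_zero, smul_zero]

/-- If `t` is missing on the way to `w`, the kernel lies in `Ker φ_{{t}ᶜ}`, which by exactness is
the image of the arrow of type `t` arriving at `v`. Such images die in `G.obj v`, while `G.incl v`
is split by `G.proj v`. -/
lemma mono_incl_connMap [hP : ∀ X : A, Projective X] (h : F.IsLinkedNet k Q) (hE : F.IsExact Q)
    (v w : V) : Mono (G.incl v ≫ F.connMap Q v w) := by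
  refine Preadditive.mono_of_cancel_zero _ fun {X} x hx => ?_
  obtain ⟨t, ht⟩ := Q.exists_relType_eq_zero v w
  rw [← Category.assoc] at hx
  have h1 := h.comp_shiftPath_compl_singleton_eq_zero (Q.admPath v w) t ht _ hx
  have hne : ({t}ᶜ : Finset (Fin (n + 1))) ≠ Finset.univ := by simp
  have hne' : ({t}ᶜ : Finset (Fin (n + 1))).Nonempty := by
    rw [Finset.nonempty_iff_ne_empty, ne_eq, Finset.compl_eq_empty_iff]
    exact singleton_ne_univ Q t
  rw [h.comp_pathMap_eq_zero_iff_connMap (Q.isAdmissible_shiftPath v hne),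
    hE.comp_connMap_eq_zero_iff (Q.areNeighbors_shift v hne hne')] at h1
  obtain ⟨y, hy⟩ := h1
  rw [← Category.comp_id x, ← G.incl_proj, ← Category.assoc, ← hy, Category.assoc,
    G.connMap_proj, comp_zero]

open Classical in
/-- The sum of the images at `w` of families of elements of the generators. -/
noncomputable def eval (w : V) (X : A) : (Π₀ v, (X ⟶ G.obj v)) →+ (X ⟶ F.objAt w) :=
  DFinsupp.sumAddHom fun v => Preadditive.rightComp X (G.incl v ≫ F.connMap Q v w)

open Classical in
lemma eval_single (w : V) {X : A} (v : V) (s : X ⟶ G.obj v) :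
    G.eval w X (DFinsupp.single v s) = s ≫ G.incl v ≫ F.connMap Q v w :=
  DFinsupp.sumAddHom_single _ _ _

lemma comp_incl_pathMap_mem_range (h : F.IsWeaklyLinkedNet k Q) {v w : V} (p : Quiver.Path v w)
    {X : A} (s : X ⟶ G.obj v) : s ≫ G.incl v ≫ F.pathMap p ∈ (G.eval w X).range := by
  classical
  by_cases hp : Q.IsAdmissible p
  · obtain ⟨c, -, hc⟩ := h.exists_eq_smul_connMap hp
    refine ⟨DFinsupp.single v (c • s), ?_⟩
    rw [eval_single, hc]
    simp
  · rw [h.pathMap_eq_zero p hp, comp_zero, comp_zero]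
    exact zero_mem _

/-- An element is its generator part plus images from predecessors. Repeating this lengthens the
remaining paths to `w` until local finiteness kills them. -/
lemma eval_surjective (h : F.IsWeaklyLinkedNet k Q) (hL : F.IsLocallyFinite) (w : V) (X : A) :
    Function.Surjective (G.eval w X) := by
  obtain ⟨l, hl⟩ := hL w
  -- Here `m` bounds how many more arrows are needed before the path exceeds the length `l`.
  have key : ∀ (m : ℕ) {u : V} (p : Quiver.Path u w), l < p.length + m →
      ∀ x : X ⟶ F.objAt u, x ≫ F.pathMap p ∈ (G.eval w X).range := by
    intro m
    induction m with
    | zero =>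
      intro u p hp x
      rw [hl p hp, comp_zero]
      exact zero_mem _
    | succ m ih =>
      intro u p hp x
      obtain ⟨y, hy⟩ := G.exists_eq_sum u (x - (x ≫ G.proj u) ≫ G.incl u) (by
        rw [Preadditive.sub_comp, Category.assoc, G.incl_proj, Category.comp_id, sub_self])
      rw [sub_eq_iff_eq_add] at hy
      rw [hy, Preadditive.add_comp, Preadditive.sum_comp]
      refine add_mem (sum_mem fun t _ => ?_) ?_
      · rw [Category.assoc, connMap, ← pathMap_comp]
        refine ih _ ?_ _
        have : (Q.admPath (Q.shift u {t}ᶜ) u).length = 1 := by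
          rw [Q.length_eq_sum_pathType]
          change ∑ s, Q.relType _ _ s = 1
          rw [Q.relType_shift_compl u (singleton_ne_univ Q t)]
          simp [ZnQuiver.indicatorType]
        rw [Quiver.Path.length_comp, this]
        omega
      · rw [Category.assoc]
        exact G.comp_incl_pathMap_mem_range h p _
  intro x
  have := key (l + 1) (.nil : Quiver.Path w w) (by simp) x
  rwa [pathMap_nil, Category.comp_id] at this

end Generators

/-- A nonzero semisimple object has a simple subobject. -/
lemma exists_simple_mono {X : A} (hX : IsSemisimpleObject X) (h0 : ¬ IsZero X) :
    ∃ (T : A) (i : T ⟶ X), Simple T ∧ Mono i := by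
  obtain ⟨m, S, b, hS, ⟨hb⟩, ⟨e⟩⟩ := hX
  rcases isEmpty_or_nonempty (Fin m) with hm | ⟨⟨j⟩⟩
  · refine absurd ?_ h0
    refine IsZero.of_iso ?_ e
    rw [IsZero.iff_id_eq_zero, ← IsBilimit.total hb]
    simp
  · have : Mono (b.ι j) := (SplitMono.mk (b.π j) (bicone_ι_π_self b j)).mono
    exact ⟨S j, b.ι j ≫ e.inv, hS j, inferInstance⟩

end QuiverRep

/-! ### Simple nets. -/

namespace LinkedNetCat

open QuiverRep

variable {k : Type w} [Field k] {n : ℕ} {V : Type u₁} [Quiver.{v₁} V] {Q : ZnQuiver n V}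
  {A : Type u₂} [Category.{v₂} A] [Abelian A] [Linear k A]

lemma exists_app_ne_zero {𝔚 𝔙 : LinkedNetCat k Q A} {f : 𝔚 ⟶ 𝔙} (hf : f ≠ 0) :
    ∃ v : V, f.hom.app ((Paths.of V).obj v) ≠ 0 := by
  by_contra! h
  exact hf (ObjectProperty.hom_ext _ (NatTrans.ext (funext h)))

lemma app_eq_zero {𝔚 𝔙 : LinkedNetCat k Q A} {f : 𝔚 ⟶ 𝔙} (hf : f = 0) (v : V) :
    f.hom.app ((Paths.of V).obj v) = 0 := by
  rw [hf]; rfl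

lemma simple_of_hasSimpleObjects [hP : ∀ X : A, Projective X] (𝔙 : LinkedNetCat k Q A)
    (h : 𝔙.obj.HasSimpleObjects) : Simple 𝔙 where
  mono_isIso_iff_nonzero {𝔚} f _ := by
    have hmono := LinkedNetCat.mono_app f
    constructor
    · intro hf h0
      obtain ⟨v, -⟩ := Q.exists_arrow 0
      have := h v
      have h1 : 𝟙 𝔙 = 0 := (IsIso.inv_hom_id f).symm.trans ((congrArg (inv f ≫ ·) h0).trans comp_zero)
      exact id_nonzero (𝔙.obj.objAt v) (app_eq_zero h1 v)
    · intro hf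
      obtain ⟨v, hv⟩ := exists_app_ne_zero hf
      refine LinkedNetCat.isIso_of_isIso_app f fun u => ?_
      have := h u
      have := hmono u
      refine isIso_of_mono_of_nonzero fun hu => hv ?_
      have hWu : IsZero (𝔚.obj.objAt u) := by
        rw [IsZero.iff_id_eq_zero, ← cancel_mono (f.hom.app ((Paths.of V).obj u)), hu, comp_zero,
          comp_zero]
      exact (IsExact.isZero_of_isZero 𝔚.property.2.1 hWu).eq_of_src _ _

/-- Since the generators are not all zero, one contains a simple `T`; the net it generates embeds in
`𝔙` and so is all of it, with every object isomorphic to `T`. -/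
lemma hasSimpleObjects_of_simple (hA : ∀ X : A, IsSemisimpleObject X) (𝔙 : LinkedNetCat k Q A)
    [Simple 𝔙] : 𝔙.obj.HasSimpleObjects := by
  have hP : ∀ X : A, Projective X := projective_of_isSemisimpleObject hA
  obtain ⟨hN, hE, hL⟩ := 𝔙.property
  obtain ⟨G⟩ := nonempty_generators (Q := Q) 𝔙.obj
  obtain ⟨v, hv⟩ : ∃ v, ¬ IsZero (G.obj v) := by
    by_contra! h0
    refine id_nonzero 𝔙 (ObjectProperty.hom_ext _ (NatTrans.ext (funext fun (w : V) => ?_)))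
    obtain ⟨s, hs⟩ := G.eval_surjective hN.toIsWeaklyLinkedNet hL w _ (𝟙 (𝔙.obj.objAt w))
    have hs0 : s = 0 := DFinsupp.ext fun v => (h0 v).eq_of_tgt _ _
    rw [hs0, map_zero] at hs
    exact hs.symm
  obtain ⟨T, i, hT, hi⟩ := exists_simple_mono (hA _) hv
  obtain ⟨c, hc, g, hg⟩ := hN.toIsWeaklyLinkedNet.exists_hom_genNet (i ≫ G.incl v)
  let 𝔓 : LinkedNetCat k Q A := ⟨genNet Q v T c, isLocallyFiniteExactLinkedNet_genNet hc⟩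
  let g' : 𝔓 ⟶ 𝔙 := ObjectProperty.homMk g
  have hmono : ∀ w : V, Mono (g'.hom.app ((Paths.of V).obj w)) := by
    intro w
    change Mono (g.app ((Paths.of V).obj w))
    rw [hg, Category.assoc]
    have := G.mono_incl_connMap hN hE v w
    infer_instance
  have : Mono g' := LinkedNetCat.mono_of_mono_app g' hmono
  have hne : g' ≠ 0 := by
    intro h0
    have h1 := app_eq_zero h0 v
    have := hmono v
    have h2 : 𝟙 (𝔓.obj.objAt v) = 0 := by
      rw [← cancel_mono (g'.hom.app ((Paths.of V).obj v)), h1, comp_zero, comp_zero]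
    exact id_nonzero T ((IsZero.iff_id_eq_zero T).1
      (IsZero.of_iso ((IsZero.iff_id_eq_zero _).2 h2) (genNetIso Q v T c v).symm))
  have := isIso_of_mono_of_nonzero hne
  intro w
  have : IsIso (g'.hom.app ((Paths.of V).obj w)) := inferInstance
  exact Simple.of_iso ((asIso (g'.hom.app ((Paths.of V).obj w))).symm ≪≫ genNetIso Q v T c w)

end LinkedNetCat

/-! ### Semisimple nets have the intersection property. -/

namespace QuiverRep

variable {k : Type w} [Field k] {n : ℕ} {V : Type u₁} [Quiver.{v₁} V] {Q : ZnQuiver n V}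
  {A : Type u₂} [Category.{v₂} A] [Abelian A] [Linear k A]

lemma IsWeaklyLinkedNet.kerOfTypes_mono {F : QuiverRep V A} (h : F.IsWeaklyLinkedNet k Q) (v : V) :
    Monotone (F.kerOfTypes Q v) := fun _ _ hJI =>
  Subobject.le_of_factors ((kerOfTypes_factors_iff _).2
    (h.comp_shiftPath_eq_zero_of_subset v hJI _ ((kerOfTypes_factors_iff _).1
      (Subobject.factors_self _))))

/-- The intersection property at `v`, on elements. -/
lemma IsWeaklyLinkedNet.intersectionPropertyAt_of_factors {F : QuiverRep V A}
    (h : F.IsWeaklyLinkedNet k Q) (v : V)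
    (H : ∀ (m : ℕ) (J : Finset (Fin (n + 1))) (I : Fin m → Finset (Fin (n + 1))) (X : A)
      (x : X ⟶ F.objAt v), (Finset.univ.sup fun l => F.kerOfTypes Q v (I l)).Factors x →
        (F.kerOfTypes Q v J).Factors x →
          (Finset.univ.sup fun l => F.kerOfTypes Q v (I l ∩ J)).Factors x) :
    F.IntersectionPropertyAt Q v := by
  intro m J I
  refine le_antisymm (Subobject.le_of_factors (H m J I _ _ (Subobject.inf_arrow_factors_left _ _)
    (Subobject.inf_arrow_factors_right _ _))) (Finset.sup_le fun l _ => le_inf ?_ ?_)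
  · exact (h.kerOfTypes_mono v Finset.inter_subset_left).trans
      (Finset.le_sup (f := fun l => F.kerOfTypes Q v (I l)) (Finset.mem_univ l))
  · exact h.kerOfTypes_mono v Finset.inter_subset_right

lemma IntersectionPropertyAt.finset_sup_inf {F : QuiverRep V A} {v : V}
    (h : F.IntersectionPropertyAt Q v) (𝓙 : Finset (Finset (Fin (n + 1))))
    (J : Finset (Fin (n + 1))) :
    𝓙.sup (F.kerOfTypes Q v) ⊓ F.kerOfTypes Q v J =
      𝓙.sup fun K => F.kerOfTypes Q v (K ∩ J) := by
  have key : ∀ f : Finset (Fin (n + 1)) → Subobject (F.objAt v),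
      𝓙.sup f = Finset.univ.sup fun l => f (𝓙.equivFin.symm l) := by
    intro f
    refine le_antisymm (Finset.sup_le fun K hK => ?_)
      (Finset.sup_le fun l _ => Finset.le_sup (f := f) (𝓙.equivFin.symm l).2)
    have := Finset.le_sup (f := fun l => f (𝓙.equivFin.symm l)) (Finset.mem_univ
      (𝓙.equivFin ⟨K, hK⟩))
    simpa using this
  rw [key, key]
  exact h _ J fun l => 𝓙.equivFin.symm l

lemma kerOfTypes_factors_comp_app {F F' : QuiverRep V A} (f : F ⟶ F') {v : V}
    {I : Finset (Fin (n + 1))} {X : A} {x : X ⟶ F.objAt v} (hx : (F.kerOfTypes Q v I).Factors x) :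
    (F'.kerOfTypes Q v I).Factors (x ≫ f.app ((Paths.of V).obj v)) := by
  rw [kerOfTypes_factors_iff] at hx ⊢
  rw [Category.assoc, ← pathMap_naturality, reassoc_of% hx, zero_comp]

lemma finset_sup_kerOfTypes_factors_comp_app [hP : ∀ X : A, Projective X] {F F' : QuiverRep V A}
    (f : F ⟶ F') {v : V} {m : ℕ} {I : Fin m → Finset (Fin (n + 1))} {X : A} {x : X ⟶ F.objAt v}
    (hx : (Finset.univ.sup fun l => F.kerOfTypes Q v (I l)).Factors x) :
    (Finset.univ.sup fun l => F'.kerOfTypes Q v (I l)).Factors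
      (x ≫ f.app ((Paths.of V).obj v)) := by
  obtain ⟨y, hy, rfl⟩ := exists_eq_sum_of_finset_sup_factors _ _ _ hx
  rw [Preadditive.sum_comp]
  exact finset_sup_factors_sum _ _ _ fun l hl => kerOfTypes_factors_comp_app f (hy l hl)

/-- Maps out of simple objects are zero or monomorphisms. A nonzero element of the intersection
forces `φ_J` and some `φ_{I l}` to vanish; then `φ_{I l ∩ J}` vanishes too, and its kernel is
everything. -/
lemma IsLinkedNet.intersectionPropertyAt_of_hasSimpleObjects [hP : ∀ X : A, Projective X]
    {F : QuiverRep V A} (h : F.IsLinkedNet k Q) (hF : F.HasSimpleObjects) (v : V) :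
    F.IntersectionPropertyAt Q v := by
  refine h.intersectionPropertyAt_of_factors v fun m J I X x hx hJ => ?_
  by_cases hx0 : x = 0
  · rw [hx0]; exact Subobject.factors_zero
  have := hF v
  have eq_zero : ∀ (K : Finset (Fin (n + 1))) (y : X ⟶ F.objAt v), y ≠ 0 →
      (F.kerOfTypes Q v K).Factors y → F.pathMap (Q.shiftPath v K) = 0 := by
    intro K y hy hK
    rw [kerOfTypes_factors_iff] at hK
    by_contra hne
    have := mono_of_nonzero_from_simple hne
    exact hy ((cancel_mono _).1 (hK.trans zero_comp.symm))
  obtain ⟨y, hy, rfl⟩ := exists_eq_sum_of_finset_sup_factors _ _ _ hx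
  obtain ⟨l, hl, hl0⟩ := Finset.exists_ne_zero_of_sum_ne_zero hx0
  have h1 := h.comp_shiftPath_inter_eq_zero v (I l) J (𝟙 _)
    (by rw [eq_zero _ _ hl0 (hy l hl), comp_zero]) (by rw [eq_zero _ _ hx0 hJ, comp_zero])
  rw [Category.id_comp] at h1
  refine Subobject.factors_of_le _ (Finset.le_sup (f := fun l => F.kerOfTypes Q v (I l ∩ J)) hl) ?_
  rw [kerOfTypes_factors_iff, h1, comp_zero]

end QuiverRep

namespace LinkedNetCat

open QuiverRep

variable {k : Type w} [Field k] {n : ℕ} {V : Type u₁} [Quiver.{v₁} V] {Q : ZnQuiver n V}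
  {A : Type u₂} [Category.{v₂} A] [Abelian A] [Linear k A]

lemma intersectionPropertyAt_of_isSemisimpleObject (hA : ∀ X : A, IsSemisimpleObject X)
    (𝔙 : LinkedNetCat k Q A) (h𝔙 : IsSemisimpleObject 𝔙) (v : V) :
    𝔙.obj.IntersectionPropertyAt Q v := by
  have hP : ∀ X : A, Projective X := projective_of_isSemisimpleObject hA
  obtain ⟨m, S, b, hS, ⟨hb⟩, ⟨e⟩⟩ := h𝔙
  let p (j : Fin m) : 𝔙 ⟶ S j := e.hom ≫ b.π j
  let q (j : Fin m) : S j ⟶ 𝔙 := b.ι j ≫ e.inv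
  have htotal : ∑ j, p j ≫ q j = 𝟙 𝔙 := by
    have h1 : ∀ j, p j ≫ q j = (e.hom ≫ (b.π j ≫ b.ι j)) ≫ e.inv := fun j => by simp [p, q]
    simp only [h1, ← Preadditive.sum_comp, ← Preadditive.comp_sum, IsBilimit.total hb]
    simp
  let ev : (𝔙 ⟶ 𝔙) →+ (𝔙.obj.objAt v ⟶ 𝔙.obj.objAt v) :=
    { toFun := fun f => f.hom.app ((Paths.of V).obj v)
      map_zero' := rfl
      map_add' := fun _ _ => rfl }
  have htotal' : ∑ j, (p j).hom.app ((Paths.of V).obj v) ≫ (q j).hom.app ((Paths.of V).obj v) =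
      𝟙 (𝔙.obj.objAt v) := by
    have := congrArg ev htotal
    rw [map_sum] at this
    exact this
  refine 𝔙.property.1.intersectionPropertyAt_of_factors v fun m' J I X x hx hJ => ?_
  -- Maps of nets preserve the kernels `Ker φ_I`, so `x` can be projected to each summand, rewritten
  -- there and mapped back.
  rw [← Category.comp_id x, ← htotal', Preadditive.comp_sum]
  refine factors_sum _ _ _ fun j _ => ?_
  have := hS j
  have hj := (S j).property.1.intersectionPropertyAt_of_hasSimpleObjects
    (hasSimpleObjects_of_simple hA (S j)) v
  rw [← Category.assoc]
  refine finset_sup_kerOfTypes_factors_comp_app (q j).hom ?_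
  rw [← hj, Subobject.inf_factors]
  exact ⟨finset_sup_kerOfTypes_factors_comp_app (p j).hom hx,
    kerOfTypes_factors_comp_app (p j).hom hJ⟩

end LinkedNetCat

/-! ### Free generation under the intersection property. -/

namespace ZnQuiver

variable {n : ℕ} {V : Type u₁} [Quiver.{v₁} V] (Q : ZnQuiver n V)

/-- The set of arrow types occurring in the admissible paths between two vertices. -/
noncomputable def relSupport (u v : V) : Finset (Fin (n + 1)) :=
  Finset.univ.filter fun t => Q.relType u v t ≠ 0

lemma mem_relSupport {u v : V} {t : Fin (n + 1)} :
    t ∈ Q.relSupport u v ↔ Q.relType u v t ≠ 0 := by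
  simp [relSupport]

lemma relSupport_ne_univ (u v : V) : Q.relSupport u v ≠ Finset.univ := by
  intro h
  obtain ⟨t, ht⟩ := Q.exists_relType_eq_zero u v
  exact Q.mem_relSupport.1 (h ▸ Finset.mem_univ t) ht

lemma relSupport_nonempty {u v : V} (h : u ≠ v) : (Q.relSupport u v).Nonempty := by
  rw [Finset.nonempty_iff_ne_empty]
  intro h0
  refine h (Q.relType_eq_zero_iff.1 (funext fun t => ?_))
  by_contra ht
  simpa [h0] using Q.mem_relSupport.2 ht

lemma indicatorType_relSupport_le (u v : V) :
    indicatorType (Q.relSupport u v) ≤ Q.relType u v := by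
  intro t
  by_cases h : Q.relType u v t = 0
  · simp [indicatorType, mem_relSupport, h]
  · simp only [indicatorType, mem_relSupport, h, ne_eq, not_false_iff, if_true]
    omega

end ZnQuiver

namespace QuiverRep

variable {k : Type w} [Field k] {n : ℕ} {V : Type u₁} [Quiver.{v₁} V] {Q : ZnQuiver n V}
  {A : Type u₂} [Category.{v₂} A] [Abelian A] [Linear k A]

lemma IsWeaklyLinkedNet.connMap_comp_shiftPath_compl {F : QuiverRep V A}
    (h : F.IsWeaklyLinkedNet k Q) {u w : V} {I : Finset (Fin (n + 1))}
    (hle : ZnQuiver.indicatorType I ≤ Q.relType u w) :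
    F.connMap Q u w ≫ F.pathMap (Q.shiftPath w Iᶜ) = 0 := by
  rw [connMap, ← pathMap_comp]
  refine h.pathMap_eq_zero _ ?_
  rintro ⟨t, ht⟩
  have h1 := hle t
  rw [Q.pathType_comp, Q.pathType_shiftPath, Pi.add_apply] at ht
  change Q.relType u w t + _ = 0 at ht
  by_cases htI : t ∈ I
  · simp [ZnQuiver.indicatorType, htI] at h1 ht
    omega
  · simp [ZnQuiver.indicatorType, htI] at ht

namespace Generators

variable {F : QuiverRep V A} (G : Generators Q F)

open Classical in
lemma eval_apply (w : V) {X : A} (s : Π₀ v, (X ⟶ G.obj v)) :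
    G.eval w X s = ∑ v ∈ s.support, s v ≫ G.incl v ≫ F.connMap Q v w :=
  DFinsupp.sumAddHom_apply _ _

lemma eval_comp_proj (h : F.IsWeaklyLinkedNet k Q) (w : V) {X : A} (s : Π₀ v, (X ⟶ G.obj v)) :
    ∃ c : k, c ≠ 0 ∧ G.eval w X s ≫ G.proj w = c • s w := by
  classical
  obtain ⟨c, hc, hcw⟩ := h.exists_connMap_self w
  refine ⟨c, hc, ?_⟩
  have hw : s w ≫ G.incl w ≫ F.connMap Q w w ≫ G.proj w = c • s w := by
    rw [hcw, Linear.smul_comp, Category.id_comp, Linear.comp_smul, G.incl_proj, Linear.comp_smul,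
      Category.comp_id]
  rw [eval_apply, Preadditive.sum_comp, Finset.sum_eq_single w, Category.assoc, Category.assoc, hw]
  · intro v _ hv
    rw [Category.assoc, Category.assoc, G.connMap_comp_proj h hv, comp_zero, comp_zero]
  · intro hw0
    rw [DFinsupp.notMem_support_iff.1 hw0, zero_comp, zero_comp]

/-- An element at `w` is generated over a set of vertices if it is a sum of images of elements of
the generators at these vertices. -/
def IsGeneratedOver (w : V) (P : V → Prop) {X : A} (y : X ⟶ F.objAt w) : Prop :=
  ∃ r, G.eval w X r = y ∧ ∀ v, P v ∨ r v = 0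

namespace IsGeneratedOver

variable {G} {w : V} {P P' : V → Prop} {X : A} {y z : X ⟶ F.objAt w}

lemma mono (hy : G.IsGeneratedOver w P y) (hP : ∀ v, P v → P' v) : G.IsGeneratedOver w P' y := by
  obtain ⟨r, hr, h⟩ := hy
  exact ⟨r, hr, fun v => (h v).imp_left (hP v)⟩

variable (G w P X) in
lemma zero : G.IsGeneratedOver w P (0 : X ⟶ F.objAt w) :=
  ⟨0, map_zero _, fun _ => Or.inr rfl⟩

lemma add (hy : G.IsGeneratedOver w P y) (hz : G.IsGeneratedOver w P z) :
    G.IsGeneratedOver w P (y + z) := by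
  obtain ⟨r, hr, h⟩ := hy
  obtain ⟨r', hr', h'⟩ := hz
  refine ⟨r + r', by rw [map_add, hr, hr'], fun v => ?_⟩
  rcases h v with hv | hv
  · exact Or.inl hv
  · exact (h' v).imp_right fun hv' => by rw [DFinsupp.add_apply, hv, hv', add_zero]

lemma sum {ι : Type*} (t : Finset ι) (y : ι → (X ⟶ F.objAt w))
    (hy : ∀ i ∈ t, G.IsGeneratedOver w P (y i)) : G.IsGeneratedOver w P (∑ i ∈ t, y i) := by
  classical
  induction t using Finset.induction_on with
  | empty => exact zero G w P X
  | insert i t hi ih =>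
    rw [Finset.sum_insert hi]
    exact (hy i (Finset.mem_insert_self i t)).add
      (ih fun j hj => hy j (Finset.mem_insert_of_mem hj))

end IsGeneratedOver

/-- Generators whose way through `u` is not admissible contribute zero; for the others types add up,
so the way to `w` contains that from `u`. -/
lemma isGeneratedOver_comp_connMap (h : F.IsWeaklyLinkedNet k Q) (hL : F.IsLocallyFinite)
    (u w : V) {X : A} (y : X ⟶ F.objAt u) :
    G.IsGeneratedOver w (fun v => Q.relType u w ≤ Q.relType v w) (y ≫ F.connMap Q u w) := by
  classical
  obtain ⟨s, rfl⟩ := G.eval_surjective h hL u X y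
  rw [eval_apply, Preadditive.sum_comp]
  refine IsGeneratedOver.sum _ _ fun v _ => ?_
  rw [Category.assoc, Category.assoc]
  by_cases hv : ∃ t, Q.relType v u t + Q.relType u w t = 0
  · obtain ⟨c, -, hc⟩ := h.exists_connMap_comp hv
    refine ⟨DFinsupp.single v (c • s v), ?_, fun v' => ?_⟩
    · rw [eval_single, hc]
      simp
    · by_cases hv' : v' = v
      · subst hv'
        left
        change Q.relType u w ≤ Q.relType v' w
        rw [Q.relType_eq_add hv]
        exact le_add_of_nonneg_left zero_le
      · exact Or.inr (DFinsupp.single_eq_of_ne hv')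
  · rw [h.connMap_comp_eq_zero hv, comp_zero, comp_zero]
    exact IsGeneratedOver.zero G w _ X

open Classical in
/-- The part of a family of elements of the generators which reaches `w` by paths of support `I`
is the image of a family evaluated at the predecessor `w - I` of `w`. -/
lemma exists_eval_filter_eq (h : F.IsWeaklyLinkedNet k Q) {w : V} {I : Finset (Fin (n + 1))}
    (hI : I ≠ Finset.univ) {X : A} (s : Π₀ v, (X ⟶ G.obj v)) :
    ∃ r : Π₀ v, (X ⟶ G.obj v),
      G.eval w X (s.filter fun v => Q.relSupport v w = I) =
        G.eval (Q.shift w Iᶜ) X r ≫ F.connMap Q (Q.shift w Iᶜ) w ∧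
      ∀ v, Q.relSupport v w = I → ∃ c : k, c ≠ 0 ∧ r v = c • s v := by
  have key : ∀ v, ∃ c : k, c ≠ 0 ∧ (Q.relSupport v w = I → F.connMap Q v w =
      c • (F.connMap Q v (Q.shift w Iᶜ) ≫ F.connMap Q (Q.shift w Iᶜ) w)) := by
    intro v
    by_cases hv : Q.relSupport v w = I
    · obtain ⟨c, hc, h1⟩ := h.exists_connMap_eq hI (hv ▸ Q.indicatorType_relSupport_le v w)
      exact ⟨c, hc, fun _ => h1⟩
    · exact ⟨1, one_ne_zero, fun hv' => absurd hv' hv⟩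
  choose c hc hc' using key
  let T : (Π₀ v, (X ⟶ G.obj v)) →+ (Π₀ v, (X ⟶ G.obj v)) :=
    DFinsupp.mapRange.addMonoidHom fun v => DistribSMul.toAddMonoidHom (X ⟶ G.obj v) (c v)
  refine ⟨T (s.filter fun v => Q.relSupport v w = I), ?_, fun v hv => ⟨c v, hc v, ?_⟩⟩
  · have : (G.eval w X).comp (DFinsupp.filterAddMonoidHom _ fun v => Q.relSupport v w = I) =
        (Preadditive.rightComp X (F.connMap Q (Q.shift w Iᶜ) w)).comp
          (((G.eval (Q.shift w Iᶜ) X).comp T).comp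
            (DFinsupp.filterAddMonoidHom _ fun v => Q.relSupport v w = I)) := by
      refine DFinsupp.addHom_ext fun v x => ?_
      simp only [AddMonoidHom.comp_apply, DFinsupp.filterAddMonoidHom_apply]
      rw [DFinsupp.filter_single]
      split_ifs with hv
      · have hT : T (DFinsupp.single v x) = DFinsupp.single v (c v • x) :=
          DFinsupp.mapRange_single (hf := fun _ => smul_zero _)
        rw [hT, eval_single, eval_single, hc' v hv]
        simp [Preadditive.rightComp]
      · simp
    exact DFunLike.congr_fun this s
  · change c v • (s.filter fun v => Q.relSupport v w = I) v = _
    rw [DFinsupp.filter_apply_pos (p := fun v => Q.relSupport v w = I) _ hv]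

section IntersectionProperty

variable [hP : ∀ X : A, Projective X]

/-- By exactness `y` comes from the predecessor `w - (Kᶜ ∪ I)`, hence through `w - I`. A type of
`Kᶜ` outside `I` is used before `w - I`, and so lies in the support of every generator involved. -/
lemma exists_isGeneratedOver_of_comp_shiftPath_eq_zero (h : F.IsLinkedNet k Q) (hE : F.IsExact Q)
    (hL : F.IsLocallyFinite) {w : V} {I K : Finset (Fin (n + 1))} (hI : I ≠ Finset.univ)
    (hI' : I.Nonempty) (hKI : ¬ Kᶜ ⊆ I) {X : A} (y : X ⟶ F.objAt w)
    (hy : y ≫ F.pathMap (Q.shiftPath w (K ∩ Iᶜ)) = 0) :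
    ∃ z : X ⟶ F.objAt (Q.shift w Iᶜ), y = z ≫ F.connMap Q (Q.shift w Iᶜ) w ∧
      G.IsGeneratedOver (Q.shift w Iᶜ) (fun v => ¬ Q.relSupport v (Q.shift w Iᶜ) ⊆ I) z := by
  set L := K ∩ Iᶜ with hL'
  have hLu : L ≠ Finset.univ := by
    obtain ⟨t, ht⟩ := hI'
    intro h0
    have := Finset.mem_univ t
    rw [← h0, hL'] at this
    simp [ht] at this
  by_cases hLe : L.Nonempty
  swap
  · rw [Finset.not_nonempty_iff_eq_empty] at hLe
    rw [h.comp_pathMap_eq_zero_iff (q := .nil) (Q.isAdmissible_shiftPath w hLu), pathMap_nil,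
      Category.comp_id] at hy
    · exact ⟨0, by rw [hy, zero_comp], IsGeneratedOver.zero G _ _ X⟩
    · rw [Q.pathType_shiftPath, hLe]
      ext t
      simp [ZnQuiver.indicatorType, Q.pathType_nil]
  rw [h.comp_pathMap_eq_zero_iff_connMap (Q.isAdmissible_shiftPath w hLu),
    hE.comp_connMap_eq_zero_iff (Q.areNeighbors_shift w hLu hLe)] at hy
  obtain ⟨z, rfl⟩ := hy
  have hrel := Q.relType_shift_self w hLe
  have hle : ZnQuiver.indicatorType I ≤ Q.relType (Q.shift w L) w := by
    intro t
    rw [hrel]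
    by_cases ht : t ∈ I <;> simp [ZnQuiver.indicatorType, ht, hL']
  obtain ⟨c, -, hc⟩ := h.exists_connMap_eq hI hle
  refine ⟨(c • z) ≫ F.connMap Q (Q.shift w L) (Q.shift w Iᶜ), by rw [hc]; simp, ?_⟩
  refine (G.isGeneratedOver_comp_connMap h.toIsWeaklyLinkedNet hL _ _ _).mono fun v hv hvI => ?_
  obtain ⟨t, htK, htI⟩ := Finset.not_subset.1 hKI
  have h1 : Q.relType (Q.shift w L) (Q.shift w Iᶜ) t + ZnQuiver.indicatorType I t =
      Q.relType (Q.shift w L) w t := congrFun (Q.relType_shift_compl_add hle) t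
  have htL : t ∈ Lᶜ := by
    rw [Finset.mem_compl] at htK
    simp [hL', htK]
  rw [hrel] at h1
  simp only [ZnQuiver.indicatorType, htI, if_false, htL, if_true] at h1
  have h2 : Q.relType (Q.shift w L) (Q.shift w Iᶜ) t ≤ Q.relType v (Q.shift w Iᶜ) t := hv t
  refine htI (hvI (Q.mem_relSupport.2 ?_))
  omega

lemma eval_apply_eq_zero_step (h : F.IsLinkedNet k Q) (hE : F.IsExact Q) (hL : F.IsLocallyFinite)
    {v w : V} (hw : F.IntersectionPropertyAt Q w) (hvw : v ≠ w) {X : A}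
    (ih₁ : ∀ v', (Q.relSupport v' w).card < (Q.relSupport v w).card →
      ∀ s : Π₀ v, (X ⟶ G.obj v), G.eval w X s = 0 → s v' = 0)
    (ih₂ : ∀ s : Π₀ v, (X ⟶ G.obj v), G.eval (Q.shift w (Q.relSupport v w)ᶜ) X s = 0 → s v = 0)
    (s : Π₀ v, (X ⟶ G.obj v)) (hs : G.eval w X s = 0) : s v = 0 := by
  classical
  have hN := h.toIsWeaklyLinkedNet
  set I := Q.relSupport v w with hIdef
  have hI : I ≠ Finset.univ := Q.relSupport_ne_univ v w
  have hI' : I.Nonempty := Q.relSupport_nonempty hvw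
  have hle : ZnQuiver.indicatorType I ≤ Q.relType v w := Q.indicatorType_relSupport_le v w
  set w' := Q.shift w Iᶜ with hw'
  obtain ⟨r, hr, hr'⟩ := G.exists_eval_filter_eq hN (w := w) hI s
  set y := G.eval w X (s.filter fun v => Q.relSupport v w = I) with hy
  have hyker : (F.kerOfTypes Q w Iᶜ).Factors y := by
    rw [kerOfTypes_factors_iff, hr, Category.assoc, hN.connMap_comp_shiftPath_compl, comp_zero]
    rw [Q.relType_shift_compl w hI]
  -- These `K` include the complements of all other supports in the relation: supports smaller than
  -- `I` are removed by `ih₁`. The cardinality bound ensures `¬ Kᶜ ⊆ I`.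
  let 𝓙 : Finset (Finset (Fin (n + 1))) :=
    Finset.univ.filter fun K => Kᶜ ≠ I ∧ I.card ≤ Kᶜ.card
  have hyneg : y = -G.eval w X (s.filter fun v => ¬ Q.relSupport v w = I) := by
    rw [eq_neg_iff_add_eq_zero, hy, ← map_add, DFinsupp.filter_add_filter_not, hs]
  have hysup : (𝓙.sup (F.kerOfTypes Q w)).Factors y := by
    rw [hyneg, ← map_neg, eval_apply]
    refine factors_sum _ _ _ fun v' hv' => ?_
    rw [DFinsupp.mem_support_iff, DFinsupp.neg_apply, neg_ne_zero] at hv'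
    have hv'I : ¬ Q.relSupport v' w = I := by
      intro h0
      exact hv' (DFinsupp.filter_apply_neg (p := fun v => ¬ Q.relSupport v w = I) _ (not_not.2 h0))
    rw [DFinsupp.filter_apply_pos (p := fun v => ¬ Q.relSupport v w = I) _ hv'I] at hv'
    have hmem : (Q.relSupport v' w)ᶜ ∈ 𝓙 := by
      simp only [𝓙, Finset.mem_filter, Finset.mem_univ, true_and, compl_compl]
      refine ⟨hv'I, ?_⟩
      by_contra! hlt
      exact hv' (ih₁ v' hlt s hs)
    refine Subobject.factors_of_le _ (Finset.le_sup hmem) ((kerOfTypes_factors_iff _).2 ?_)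
    rw [Category.assoc, Category.assoc,
      hN.connMap_comp_shiftPath_compl (Q.indicatorType_relSupport_le v' w), comp_zero, comp_zero]
  -- The intersection property enters here: `y` lies both in the sum of the kernels of the other
  -- groups and in `Ker φ_{Iᶜ}`.
  have hyJ : (𝓙.sup fun K => F.kerOfTypes Q w (K ∩ Iᶜ)).Factors y := by
    rw [← hw.finset_sup_inf, Subobject.inf_factors]
    exact ⟨hysup, hyker⟩
  obtain ⟨y', hy', hysum⟩ := exists_eq_sum_of_finset_sup_factors _ _ _ hyJ
  have hz : ∀ K ∈ 𝓙, ∃ z : X ⟶ F.objAt w', y' K = z ≫ F.connMap Q w' w ∧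
      G.IsGeneratedOver w' (fun v => ¬ Q.relSupport v w' ⊆ I) z := by
    intro K hK
    refine G.exists_isGeneratedOver_of_comp_shiftPath_eq_zero h hE hL hI hI' ?_ _
      ((kerOfTypes_factors_iff _).1 (hy' K hK))
    simp only [𝓙, Finset.mem_filter, Finset.mem_univ, true_and] at hK
    exact fun hsub => hK.1 (Finset.eq_of_subset_of_card_le hsub hK.2)
  choose! z hz hzG using hz
  have hdiff : (G.eval w' X r - ∑ K ∈ 𝓙, z K) ≫ F.connMap Q w' w = 0 := by
    rw [Preadditive.sub_comp, ← hr, hysum, Preadditive.sum_comp, sub_eq_zero]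
    exact Finset.sum_congr rfl hz
  have hneigh : Q.AreNeighbors w' w := by
    have := Q.areNeighbors_shift w' hI hI'
    rwa [hw', Q.shift_compl_shift] at this
  obtain ⟨z', hz'⟩ := (hE.comp_connMap_eq_zero_iff hneigh _).1 hdiff
  -- An element arriving from `w` has passed all types of `Iᶜ`, which is nonempty because `I` is
  -- proper.
  have hz'G : G.IsGeneratedOver w' (fun v => ¬ Q.relSupport v w' ⊆ I) (z' ≫ F.connMap Q w w') := by
    refine (G.isGeneratedOver_comp_connMap hN hL _ _ _).mono fun v' hv' hsub => ?_
    obtain ⟨t, ht⟩ := ZnQuiver.exists_not_mem hI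
    have hIc : Iᶜ ≠ Finset.univ := by
      rw [ne_eq, Finset.compl_eq_univ_iff]
      exact hI'.ne_empty
    have h1 := hv' t
    rw [hw', Q.relType_shift w hIc] at h1
    refine ht (hsub (Q.mem_relSupport.2 ?_))
    simp only [ZnQuiver.indicatorType, Finset.mem_compl, ht, not_false_iff, if_true] at h1
    rw [hw']
    omega
  obtain ⟨r', hr'1, hr'2⟩ := hz'G.add (IsGeneratedOver.sum 𝓙 z hzG)
  have hrr : G.eval w' X (r - r') = 0 := by
    rw [map_sub, hr'1, hz', sub_add_cancel, sub_self]
  -- The correction `r'` has no component at `v`, whose support to `w'` lies in `I`; so the relation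
  -- at `w'` kills the multiple `r v` of `s v`.
  have h0 := ih₂ _ hrr
  have hsub : Q.relSupport v w' ⊆ I := by
    intro t ht
    have h1 : Q.relType v w' t + ZnQuiver.indicatorType I t = Q.relType v w t :=
      congrFun (Q.relType_shift_compl_add hle) t
    rw [Q.mem_relSupport] at ht
    rw [hIdef, Q.mem_relSupport, ← h1]
    omega
  rw [DFinsupp.sub_apply, (hr'2 v).resolve_left (not_not.2 hsub), sub_zero] at h0
  obtain ⟨c, hc, hcv⟩ := hr' v rfl
  rw [hcv] at h0
  exact (smul_eq_zero_iff_right hc).1 h0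

lemma eval_injective (h : F.IsLinkedNet k Q) (hE : F.IsExact Q) (hL : F.IsLocallyFinite)
    (hI : ∀ v, F.IntersectionPropertyAt Q v) (w : V) (X : A) :
    Function.Injective (G.eval w X) := by
  -- The double induction is on the number of types, then on the length of the way from `v` to `w`.
  -- Passing to `w'` shortens the way without enlarging its support.
  suffices H : ∀ (a b : ℕ) (v w : V), (Q.relSupport v w).card = a → ∑ t, Q.relType v w t = b →
      ∀ s : Π₀ v, (X ⟶ G.obj v), G.eval w X s = 0 → s v = 0 from
    (injective_iff_map_eq_zero _).2 fun s hs => DFinsupp.ext fun v => H _ _ v w rfl rfl s hs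
  intro a
  induction a using Nat.strong_induction_on with
  | _ a iha =>
  intro b
  induction b using Nat.strong_induction_on with
  | _ b ihb =>
  intro v w ha hb s hs
  by_cases hvw : v = w
  · subst hvw
    obtain ⟨c, hc, hcs⟩ := G.eval_comp_proj h.toIsWeaklyLinkedNet v s
    rw [hs, zero_comp] at hcs
    exact (smul_eq_zero_iff_right hc).1 hcs.symm
  refine G.eval_apply_eq_zero_step h hE hL (hI w) hvw
    (fun v' hv' => iha _ (ha ▸ hv') _ v' w rfl rfl) ?_ s hs
  have hadd := Q.relType_shift_compl_add (Q.indicatorType_relSupport_le v w)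
  set w' := Q.shift w (Q.relSupport v w)ᶜ
  have hsub : Q.relSupport v w' ⊆ Q.relSupport v w := by
    intro t ht
    have h1 := congrFun hadd t
    rw [Pi.add_apply] at h1
    rw [Q.mem_relSupport] at ht ⊢
    rw [← h1]
    omega
  rcases (Finset.card_le_card hsub).lt_or_eq with hlt | heq
  · exact iha _ (ha ▸ hlt) _ v w' rfl rfl
  · refine ihb _ ?_ v w' (heq.trans ha) rfl
    rw [← hb, ← hadd]
    simp only [Pi.add_apply, Finset.sum_add_distrib]
    refine Nat.lt_add_of_pos_right ?_
    obtain ⟨t, ht⟩ := Q.relSupport_nonempty hvw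
    refine Finset.sum_pos' (fun _ _ => Nat.zero_le _) ⟨t, Finset.mem_univ t, ?_⟩
    simp [ZnQuiver.indicatorType, ht]

end IntersectionProperty

end Generators

end QuiverRep

/-! ### Decomposition into simple nets. -/

namespace QuiverRep

/-- The decomposition of a semisimple object, in terms of morphisms. -/
lemma exists_simple_decomposition {A : Type u₂} [Category.{v₂} A] [Abelian A] {X : A}
    (hX : IsSemisimpleObject X) :
    ∃ (m : ℕ) (S : Fin m → A) (ι : ∀ i, S i ⟶ X) (π : ∀ i, X ⟶ S i), (∀ i, Simple (S i)) ∧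
      (∀ i, ι i ≫ π i = 𝟙 _) ∧ (∀ i j, i ≠ j → ι i ≫ π j = 0) ∧ ∑ i, π i ≫ ι i = 𝟙 X := by
  obtain ⟨m, S, b, hS, ⟨hb⟩, ⟨e⟩⟩ := hX
  refine ⟨m, S, fun i => b.ι i ≫ e.inv, fun i => e.hom ≫ b.π i, hS, fun i => by simp,
    fun i j hij => by simp [bicone_ι_π_ne b hij], ?_⟩
  have h1 : ∀ i, (e.hom ≫ b.π i) ≫ b.ι i ≫ e.inv = (e.hom ≫ (b.π i ≫ b.ι i)) ≫ e.inv :=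
    fun i => by simp
  simp only [h1, ← Preadditive.sum_comp, ← Preadditive.comp_sum, IsBilimit.total hb]
  simp

variable {k : Type w} [Field k] {n : ℕ} {V : Type u₁} [Quiver.{v₁} V] {Q : ZnQuiver n V}
  {A : Type u₂} [Category.{v₂} A] [Abelian A] [Linear k A]

namespace Generators

variable {F : QuiverRep V A} (G : Generators Q F)

lemma eval_comp (w : V) {X Y : A} (x : X ⟶ Y) (s : Π₀ v, (Y ⟶ G.obj v)) :
    ∃ r : Π₀ v, (X ⟶ G.obj v), G.eval w X r = x ≫ G.eval w Y s ∧ ∀ v, r v = x ≫ s v := by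
  classical
  let T : (Π₀ v, (Y ⟶ G.obj v)) →+ (Π₀ v, (X ⟶ G.obj v)) :=
    DFinsupp.mapRange.addMonoidHom fun v => Preadditive.leftComp (G.obj v) x
  refine ⟨T s, ?_, fun v => rfl⟩
  have : (G.eval w X).comp T = (Preadditive.leftComp (F.objAt w) x).comp (G.eval w Y) := by
    refine DFinsupp.addHom_ext fun v y => ?_
    have hT : T (DFinsupp.single v y) =
        DFinsupp.single (β := fun v => X ⟶ G.obj v) v (x ≫ y) :=
      DFinsupp.mapRange_single (hf := fun _ => comp_zero)
    rw [AddMonoidHom.comp_apply, AddMonoidHom.comp_apply, hT, eval_single, eval_single]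
    exact Category.assoc _ _ _
  exact DFunLike.congr_fun this s

/-- If the generators generate freely then they are almost all zero. -/
lemma exists_finset_isZero (w : V) (hinj : ∀ X, Function.Injective (G.eval w X))
    (hsurj : ∀ X, Function.Surjective (G.eval w X)) :
    ∃ t : Finset V, ∀ v ∉ t, IsZero (G.obj v) := by
  classical
  obtain ⟨s, hs⟩ := hsurj _ (𝟙 (F.objAt w))
  refine ⟨s.support, fun v hv => ?_⟩
  rw [DFinsupp.notMem_support_iff] at hv
  -- Expanding the image of `𝟙 (G.obj v)` through the expansion `s` of the identity gives a family
  -- with no `v` component. By injectivity it is the original one, so `𝟙 (G.obj v) = 0`.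
  obtain ⟨r, hr, hr'⟩ := G.eval_comp w (G.eval w _ (DFinsupp.single v (𝟙 (G.obj v)))) s
  rw [hs, Category.comp_id] at hr
  have h1 := hr' v
  rw [hinj _ hr, DFinsupp.single_eq_same, hv, comp_zero] at h1
  exact (IsZero.iff_id_eq_zero _).2 h1

end Generators

end QuiverRep

namespace LinkedNetCat

open QuiverRep

variable {k : Type w} [Field k] {n : ℕ} {V : Type u₁} [Quiver.{v₁} V] {Q : ZnQuiver n V}
  {A : Type u₂} [Category.{v₂} A] [Abelian A] [Linear k A]

/-- A net which is at each vertex the direct sum of a finite family of nets mapping to it is the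
direct sum of the family. -/
lemma exists_bicone_of_app {M : ℕ} {𝔙 : LinkedNetCat k Q A} (P : Fin M → LinkedNetCat k Q A)
    (g : ∀ j, P j ⟶ 𝔙)
    (hinj : ∀ (w : V) (X : A) (y : ∀ j, X ⟶ (P j).obj.objAt w),
      ∑ j, y j ≫ (g j).hom.app ((Paths.of V).obj w) = 0 → ∀ j, y j = 0)
    (hsurj : ∀ (w : V) (X : A) (x : X ⟶ 𝔙.obj.objAt w), ∃ y : ∀ j, X ⟶ (P j).obj.objAt w,
      ∑ j, y j ≫ (g j).hom.app ((Paths.of V).obj w) = x) :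
    ∃ b : Bicone P, Nonempty b.IsBilimit ∧ Nonempty (𝔙 ≅ b.pt) := by
  -- The direct sum is formed among all representations and compared with `𝔙`; carrying its
  -- structure over to `𝔙` avoids proving that it is itself a linked net.
  have := HasFiniteBiproducts.of_hasFiniteProducts (C := QuiverRep V A)
  let P' : Fin M → QuiverRep V A := fun j => (P j).obj
  let D : ⨁ P' ⟶ 𝔙.obj := biproduct.desc fun j => (g j).hom
  let ev (w : V) (X Y : QuiverRep V A) : (X ⟶ Y) →+ (X.objAt w ⟶ Y.objAt w) :=
    { toFun := fun f => f.app ((Paths.of V).obj w)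
      map_zero' := rfl
      map_add' := fun _ _ => rfl }
  have hι : ∀ j, biproduct.ι P' j ≫ D = (g j).hom := fun j => biproduct.ι_desc _ _
  have hD : ∀ w : V, IsIso (D.app ((Paths.of V).obj w)) := by
    intro w
    have hmono : Mono (D.app ((Paths.of V).obj w)) := by
      refine Preadditive.mono_of_cancel_zero _ fun {X} x hx => ?_
      have htot : ∑ j, ev w _ _ (biproduct.π P' j) ≫ ev w _ _ (biproduct.ι P' j) =
          𝟙 ((⨁ P').objAt w) := by
        have := congrArg (ev w _ _) (biproduct.total (f := P'))
        rw [map_sum] at this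
        exact this
      have hxsum : x = ∑ j, (x ≫ ev w _ _ (biproduct.π P' j)) ≫ ev w _ _ (biproduct.ι P' j) := by
        simp only [Category.assoc, ← Preadditive.comp_sum, htot]
        exact (Category.comp_id x).symm
      have hcomp : ∀ j, ev w _ _ (biproduct.ι P' j) ≫ D.app ((Paths.of V).obj w) =
          (g j).hom.app ((Paths.of V).obj w) := fun j => congrArg (ev w _ _) (hι j)
      have h0 := hinj w X (fun j => x ≫ ev w _ _ (biproduct.π P' j)) (by
        rw [hxsum, Preadditive.sum_comp] at hx
        simpa only [Category.assoc, hcomp] using hx)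
      rw [hxsum]
      exact Finset.sum_eq_zero fun j _ => by rw [h0 j, zero_comp]
    obtain ⟨y, hy⟩ := hsurj w _ (𝟙 _)
    have hsec : (∑ j, y j ≫ ev w _ _ (biproduct.ι P' j)) ≫ D.app ((Paths.of V).obj w) = 𝟙 _ := by
      rw [← hy, Preadditive.sum_comp]
      refine Finset.sum_congr rfl fun j _ => ?_
      rw [Category.assoc]
      exact congrArg (y j ≫ ·) (congrArg (ev w _ _) (hι j))
    have : IsSplitEpi (D.app ((Paths.of V).obj w)) := ⟨⟨⟨_, hsec⟩⟩⟩
    exact isIso_of_mono_of_isSplitEpi _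
  have hDiso : IsIso D := by
    have : ∀ X, IsIso (D.app X) := hD
    exact NatIso.isIso_of_isIso_app D
  let b : Bicone P :=
    { pt := 𝔙
      π := fun j => ObjectProperty.homMk (inv D ≫ biproduct.π P' j)
      ι := g
      ι_π := by
        intro i j
        have h1 : (g i).hom ≫ inv D ≫ biproduct.π P' j = biproduct.ι P' i ≫ biproduct.π P' j := by
          rw [← hι i, Category.assoc, IsIso.hom_inv_id_assoc]
        refine ObjectProperty.hom_ext _ (h1.trans ?_)
        by_cases hij : i = j
        · subst hij
          rw [dif_pos rfl, biproduct.ι_π_self]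
          rfl
        · rw [dif_neg hij, biproduct.ι_π_ne _ hij]
          rfl }
  refine ⟨b, ⟨isBilimitOfTotal b ?_⟩, ⟨Iso.refl 𝔙⟩⟩
  let hom : (𝔙 ⟶ 𝔙) →+ (𝔙.obj ⟶ 𝔙.obj) :=
    { toFun := fun f => f.hom
      map_zero' := rfl
      map_add' := fun _ _ => rfl }
  refine ObjectProperty.hom_ext _ ?_
  change hom (∑ j, b.π j ≫ b.ι j) = 𝟙 _
  rw [map_sum]
  have h1 : ∀ j, hom (b.π j ≫ b.ι j) = inv D ≫ (biproduct.π P' j ≫ biproduct.ι P' j) ≫ D := by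
    intro j
    rw [Category.assoc, hι j, ← Category.assoc]
    rfl
  simp only [h1, ← Preadditive.sum_comp, ← Preadditive.comp_sum, biproduct.total]
  simp

lemma isSemisimpleObject_of_intersectionPropertyAt (hA : ∀ X : A, IsSemisimpleObject X)
    (𝔙 : LinkedNetCat k Q A) (hI : ∀ v, 𝔙.obj.IntersectionPropertyAt Q v) :
    IsSemisimpleObject 𝔙 := by
  classical
  have hP : ∀ X : A, Projective X := projective_of_isSemisimpleObject hA
  obtain ⟨hN, hE, hL⟩ := 𝔙.property
  obtain ⟨G⟩ := nonempty_generators (Q := Q) 𝔙.obj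
  have hinj := G.eval_injective hN hE hL hI
  have hsurj := G.eval_surjective hN.toIsWeaklyLinkedNet hL
  obtain ⟨w₀, -⟩ := Q.exists_arrow 0
  obtain ⟨t, ht⟩ := G.exists_finset_isZero w₀ (hinj w₀) (hsurj w₀)
  choose m S ι π hS hιπ hιπ0 htotal using fun v => exists_simple_decomposition (hA (G.obj v))
  choose c hc g hg using fun (p : Σ v : t, Fin (m v)) =>
    hN.toIsWeaklyLinkedNet.exists_hom_genNet (ι p.1 p.2 ≫ G.incl p.1)
  let e := (Fintype.equivFin (Σ v : t, Fin (m v))).symm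
  let P : Fin (Fintype.card (Σ v : t, Fin (m v))) → LinkedNetCat k Q A := fun j =>
    ⟨genNet Q (e j).1 (S _ (e j).2) (c (e j)), isLocallyFiniteExactLinkedNet_genNet (hc (e j))⟩
  have hsimple : ∀ j, Simple (P j) := fun j => simple_of_hasSimpleObjects _ fun w =>
    have := hS _ (e j).2
    Simple.of_iso (genNetIso Q _ (S _ (e j).2) (c (e j)) w)
  let i (j) (w : V) : (P j).obj.objAt w ≅ S _ (e j).2 := genNetIso Q _ (S _ (e j).2) (c (e j)) w
  have happ : ∀ j (w : V), (g (e j)).app ((Paths.of V).obj w) =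
      ((i j w).hom ≫ ι _ (e j).2) ≫ G.incl (e j).1 ≫ 𝔙.obj.connMap Q (e j).1 w := by
    intro j w
    rw [hg, Category.assoc, Category.assoc]
  refine Exists.elim (exists_bicone_of_app (𝔙 := 𝔙) P
    (fun j => ObjectProperty.homMk (g (e j))) ?_ ?_) fun b hb => ⟨_, P, b, hsimple, hb⟩
  · intro w X y hy j
    have hs : ∑ j, DFinsupp.single (β := fun v => X ⟶ G.obj v) ((e j).1 : V)
        (y j ≫ (i j w).hom ≫ ι _ (e j).2) = 0 := by
      refine hinj w X ?_
      rw [map_zero, map_sum, ← hy]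
      refine Finset.sum_congr rfl fun j _ => ?_
      rw [G.eval_single, Category.assoc]
      exact congrArg (y j ≫ ·) (happ j w).symm
    -- Projecting to one simple summand of one generator isolates a single `y j`: other vertices
    -- give other components, and other summands at the same vertex are orthogonal.
    have hne : ∀ (p q : Σ v : t, Fin (m v)) (x : X ⟶ S p.1 p.2), p ≠ q →
        (DFinsupp.single (β := fun v => X ⟶ G.obj v) (p.1 : V) (x ≫ ι _ p.2)) q.1 ≫ π _ q.2 = 0 := by
      rintro ⟨v, a⟩ ⟨v', a'⟩ x hpq
      by_cases hv : v = v'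
      · subst hv
        rw [DFinsupp.single_eq_same, Category.assoc, hιπ0, comp_zero]
        rintro rfl
        exact hpq rfl
      · rw [DFinsupp.single_eq_of_ne, zero_comp]
        exact fun h => hv (Subtype.ext h).symm
    have h1 := congrArg (fun s => s ((e j).1 : V) ≫ π _ (e j).2) hs
    rw [DFinsupp.finsetSum_apply, Preadditive.sum_comp, Finset.sum_eq_single j,
      DFinsupp.single_eq_same, DFinsupp.zero_apply, zero_comp] at h1
    · simp only [Category.assoc, hιπ, Category.comp_id] at h1
      rw [← cancel_mono (i j w).hom, h1, zero_comp]
    · intro j' _ hj'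
      rw [← Category.assoc]
      exact hne _ _ _ fun h => hj' (e.injective h)
    · exact fun h => absurd (Finset.mem_univ j) h
  · intro w X x
    obtain ⟨s, rfl⟩ := hsurj w X x
    refine ⟨fun j => s (e j).1 ≫ π _ (e j).2 ≫ (i j w).inv, ?_⟩
    have h1 : ∀ j, (s (e j).1 ≫ π _ (e j).2 ≫ (i j w).inv) ≫
        (ObjectProperty.homMk (P := isLocallyFiniteExactLinkedNet k Q A) (X := P j) (Y := 𝔙)
          (g (e j))).hom.app ((Paths.of V).obj w) =
        s (e j).1 ≫ (π _ (e j).2 ≫ ι _ (e j).2) ≫ G.incl (e j).1 ≫ 𝔙.obj.connMap Q (e j).1 w := by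
      intro j
      refine (congrArg (_ ≫ ·) (happ j w)).trans ?_
      simp
    rw [Finset.sum_congr rfl fun j _ => h1 j,
      e.sum_comp fun p => s p.1 ≫ (π _ p.2 ≫ ι _ p.2) ≫ G.incl p.1 ≫ 𝔙.obj.connMap Q p.1 w,
      Fintype.sum_sigma]
    simp only [← Preadditive.comp_sum, ← Preadditive.sum_comp, htotal, Category.id_comp]
    rw [Finset.sum_coe_sort t fun v => s v ≫ G.incl v ≫ 𝔙.obj.connMap Q v w, G.eval_apply]
    refine (Finset.sum_subset (fun v hv => ?_) fun v _ hv => ?_).symm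
    · by_contra hvt
      exact (DFinsupp.mem_support_iff.1 hv) ((ht v hvt).eq_of_tgt _ _)
    · rw [DFinsupp.notMem_support_iff.1 hv, zero_comp]

end LinkedNetCat

theorem mainTheorem1 (k : Type w) [Field k] {n : ℕ} {V : Type u₁} [Quiver.{v₁} V]
    (Q : ZnQuiver n V) (A : Type u₂) [Category.{v₂} A] [Abelian A] [Linear k A]
    (hA : ∀ X : A, IsSemisimpleObject X) (𝔙 : LinkedNetCat k Q A) :
    (Simple 𝔙 ↔ 𝔙.obj.HasSimpleObjects) ∧
      (IsSemisimpleObject 𝔙 ↔ ∀ v : V, 𝔙.obj.IntersectionPropertyAt Q v) := by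
  have hP : ∀ X : A, Projective X := projective_of_isSemisimpleObject hA
  exact ⟨⟨fun _ => LinkedNetCat.hasSimpleObjects_of_simple hA 𝔙,
      LinkedNetCat.simple_of_hasSimpleObjects 𝔙⟩,
    ⟨fun h => LinkedNetCat.intersectionPropertyAt_of_isSemisimpleObject hA 𝔙 h,
      LinkedNetCat.isSemisimpleObject_of_intersectionPropertyAt hA 𝔙⟩⟩
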